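/- Let $N\ge 2$ and let $\Omega\subset\mathbb R^N$ be a bounded domain (open, connected, non-empty). Put $R=\sup_{x\in\Omega}|x|$, let $B_R$ be the open ball of radius $R$ centred at the origin, and let $$C_N(\Omega)=\inf_{u\in W^{1,N}_0(\Omega),\,u\not\equiv 0}\ \frac{\int_\Omega|\nabla u|^N\,dx}{\int_\Omega \frac{|u(x)|^N}{|x|^N\left(\log\frac{R}{|x|}\right)^N}\,dx},$$ where $W^{1,N}_0(\Omega)$ is the closure of $C_c^\infty(\Omega)$ in the Sobolev space $W^{1,N}(\Omega)$ of real-valued functions. Assume that some point $x_0\in\partial\Omega\cap\partial B_R$ satisfies an interior sphere condition, that is, there is an open ball $B\subset\Omega$ with $x_0\in\partial B$. Then $$C_N(\Omega)=\left(\frac{N-1}{N}\right)^N,$$ and the infimum is not attained by any $u\in W^{1,N}_0(\Omega)$ with $u\not\equiv 0$. -/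

import Mathlib

open MeasureTheory Set Metric
open scoped ENNReal ContDiff

noncomputable section

namespace CriticalHardy

/-- `φ ∈ C_c^∞(Ω)`: a smooth real function whose support is a compact subset of `Ω`. -/
def IsTestFunction {N : ℕ} (Ω : Set (EuclideanSpace ℝ (Fin N)))
    (φ : EuclideanSpace ℝ (Fin N) → ℝ) : Prop :=
  ContDiff ℝ ∞ φ ∧ HasCompactSupport φ ∧ tsupport φ ⊆ Ω

/-- `g` is the weak (distributional) gradient of `u` on `Ω`; it is determined by `u` up to
null sets when `Ω` is open. -/
def HasWeakGradient {N : ℕ} (Ω : Set (EuclideanSpace ℝ (Fin N)))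
    (u : EuclideanSpace ℝ (Fin N) → ℝ)
    (g : EuclideanSpace ℝ (Fin N) → EuclideanSpace ℝ (Fin N)) : Prop :=
  LocallyIntegrableOn u Ω ∧ LocallyIntegrableOn g Ω ∧
    ∀ φ : EuclideanSpace ℝ (Fin N) → ℝ, IsTestFunction Ω φ →
      ∫ x in Ω, u x • gradient φ x = -∫ x in Ω, φ x • g x

/-- `u ∈ W^{1,p}(Ω)` with weak gradient `g`. -/
def IsSobolev {N : ℕ} (p : ℝ≥0∞) (Ω : Set (EuclideanSpace ℝ (Fin N)))
    (u : EuclideanSpace ℝ (Fin N) → ℝ)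
    (g : EuclideanSpace ℝ (Fin N) → EuclideanSpace ℝ (Fin N)) : Prop :=
  MemLp u p (volume.restrict Ω) ∧ MemLp g p (volume.restrict Ω) ∧ HasWeakGradient Ω u g

/-- `u ∈ W_0^{1,p}(Ω)` with weak gradient `g`: `u` lies in the closure of `C_c^∞(Ω)` in the norm
of `W^{1,p}(Ω)`. -/
def IsSobolevZero {N : ℕ} (p : ℝ≥0∞) (Ω : Set (EuclideanSpace ℝ (Fin N)))
    (u : EuclideanSpace ℝ (Fin N) → ℝ)
    (g : EuclideanSpace ℝ (Fin N) → EuclideanSpace ℝ (Fin N)) : Prop :=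
  IsSobolev p Ω u g ∧
    ∀ ε : ℝ≥0∞, 0 < ε → ∃ φ : EuclideanSpace ℝ (Fin N) → ℝ, IsTestFunction Ω φ ∧
      eLpNorm (fun x => u x - φ x) p (volume.restrict Ω) +
        eLpNorm (fun x => g x - gradient φ x) p (volume.restrict Ω) < ε

/-- `u ∈ W_0^{1,N}(Ω)`, `u ≢ 0`, with weak gradient `g`. -/
def Admissible {N : ℕ} (Ω : Set (EuclideanSpace ℝ (Fin N)))
    (u : EuclideanSpace ℝ (Fin N) → ℝ)
    (g : EuclideanSpace ℝ (Fin N) → EuclideanSpace ℝ (Fin N)) : Prop :=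
  IsSobolevZero (N : ℝ≥0∞) Ω u g ∧ ¬ u =ᵐ[volume.restrict Ω] 0

/-- `R = sup_{x ∈ Ω} |x|`. -/
def outerRadius {N : ℕ} (Ω : Set (EuclideanSpace ℝ (Fin N))) : ℝ :=
  sSup ((fun x => ‖x‖) '' Ω)

/-- The weight `W_R(x) = 1 / (|x|^N (log (R / |x|))^N)`. -/
def weight {N : ℕ} (R : ℝ) (x : EuclideanSpace ℝ (Fin N)) : ℝ :=
  1 / (‖x‖ ^ N * Real.log (R / ‖x‖) ^ N)

/-- The quotient `∫_Ω |∇u|^N dx / ∫_Ω W_R |u|^N dx`, where `g` stands for `∇u`. Both integrals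
are Lebesgue integrals with values in `[0, ∞]`, so that no integrability is presupposed. -/
def quotient {N : ℕ} (Ω : Set (EuclideanSpace ℝ (Fin N)))
    (u : EuclideanSpace ℝ (Fin N) → ℝ)
    (g : EuclideanSpace ℝ (Fin N) → EuclideanSpace ℝ (Fin N)) : ℝ≥0∞ :=
  (∫⁻ x in Ω, ENNReal.ofReal (‖g x‖ ^ N)) /
    ∫⁻ x in Ω, ENNReal.ofReal (weight (outerRadius Ω) x * |u x| ^ N)

/-- The best constant `C_N(Ω)`, the infimum of the quotient over `W_0^{1,N}(Ω) ∖ {0}`. -/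
def bestConstant {N : ℕ} (Ω : Set (EuclideanSpace ℝ (Fin N))) : ℝ≥0∞ :=
  sInf {q | ∃ u g, Admissible Ω u g ∧ q = quotient Ω u g}

/-- The infimum `C_N(Ω)` is attained. -/
def IsAttained {N : ℕ} (Ω : Set (EuclideanSpace ℝ (Fin N))) : Prop :=
  ∃ u g, Admissible Ω u g ∧ quotient Ω u g = bestConstant Ω

/-- Interior sphere condition at `x₀`: some open ball `B ⊆ Ω` has `x₀ ∈ ∂B`. -/
def InteriorSphereCondition {N : ℕ} (Ω : Set (EuclideanSpace ℝ (Fin N)))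
    (x₀ : EuclideanSpace ℝ (Fin N)) : Prop :=
  ∃ (c : EuclideanSpace ℝ (Fin N)) (r : ℝ), 0 < r ∧ ball c r ⊆ Ω ∧ x₀ ∈ frontier (ball c r)

end CriticalHardy

end

namespace CriticalHardy
open Filter Topology

variable {N : ℕ}

/-! Write `τ = log (R / |x|)`, `A = |u| / (|x| τ)` and `α = (N - 1) / N`, so that the denominator is
`∫ A ^ N`.

Lower bound: integrate the divergence of the field `|u|^N |x|^{-N} B(τ) x`. Since `x · ∇|x|^{-N} =
-N |x|^{-N}` and `x · ∇τ = -1`, the dimension cancels, and only the derivative of `|u|^N` and the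
term with `B'` survive (`integral_test_radialWeight`). For `B = τ^{1-N}` this bounds `(N - 1) ∫ A^N`
by `N ∫ A^{N-1} |∇u|`, and Young's inequality for `α A` and `|∇u|` yields the constant `α^N`
(`hardy_pointwise`, `hardy_test`). Density carries it to `W_0^{1,N}` (`IsSobolevZero.hardy`).

Non-attainment: at equality, Young's inequality is an equality almost everywhere, which fixes the
cross term `|u|^{N-2} u ∇u · x` pointwise in terms of `A^N`. Inserting this into the identity for `B
= τ^{1-N} arctan τ` cancels everything except `∫ A^N τ / (1 + τ²) = 0`, so `u = 0`
(`IsSobolevZero.eq_zero_of_hardy_eq`). The shape of a would-be minimizer is never needed.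

Upper bound: let `t` be the distance to the tangent hyperplane at `x₀`. The weight is at least
`t^{-N}`, so functions nearly optimal for the half-space Hardy inequality suffice: `t^α Φ` with `Φ`
slowly varying on the scale `t`. In the coordinates `t = l exp (k s)`, with tangential variables
scaled by `L`, the measure `dx / t` is a constant times Lebesgue measure and the gradient of `Φ`
costs only `O(1 / k)`. For `l` small, depending on `k`, the support fits into the interior ball, and
`k → ∞` gives `α^N` (`exists_test_hardy_le`). -/

/-! ### The radial integration-by-parts identity for test functions -/

/-- The integrand is the divergence of `h x • x`; it is integrated by parts one coordinate at a
time. -/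
theorem integral_dim_mul_add_fderiv_self {h : EuclideanSpace ℝ (Fin N) → ℝ}
    (hh : ContDiff ℝ 1 h) (hc : HasCompactSupport h) :
    ∫ x, ((N : ℝ) * h x + fderiv ℝ h x x) = 0 := by
  have hcont : Continuous (fderiv ℝ h) := hh.continuous_fderiv one_ne_zero
  have hint : Integrable h := hh.continuous.integrable_of_hasCompactSupport hc
  set e := EuclideanSpace.basisFun (Fin N) ℝ with he
  have hint_i : ∀ i : Fin N, Integrable fun x : EuclideanSpace ℝ (Fin N) =>
      x i * fderiv ℝ h x (e i) := fun i => by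
    refine Continuous.integrable_of_hasCompactSupport (by fun_prop) ?_
    exact HasCompactSupport.mul_left ((hc.fderiv ℝ).comp_left
      (g := fun L : EuclideanSpace ℝ (Fin N) →L[ℝ] ℝ => L (e i)) rfl)
  have hparts : ∀ i : Fin N, ∫ x : EuclideanSpace ℝ (Fin N), x i * fderiv ℝ h x (e i)
      = -∫ x, h x := fun i => by
    have hf : ∀ x : EuclideanSpace ℝ (Fin N),
        HasFDerivAt (fun x : EuclideanSpace ℝ (Fin N) => x i)
        (EuclideanSpace.proj i : EuclideanSpace ℝ (Fin N) →L[ℝ] ℝ) x := fun x =>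
      (EuclideanSpace.proj i : EuclideanSpace ℝ (Fin N) →L[ℝ] ℝ).hasFDerivAt
    have hone : ∀ x : EuclideanSpace ℝ (Fin N),
        fderiv ℝ (fun x : EuclideanSpace ℝ (Fin N) => x i) x (e i) = 1 := fun x => by
      rw [(hf x).fderiv]; simp [he]
    rw [integral_mul_fderiv_eq_neg_fderiv_mul_of_integrable]
    · simp [hone]
    · simpa [hone] using hint
    · exact hint_i i
    · refine Continuous.integrable_of_hasCompactSupport (by fun_prop) hc.mul_left
    · exact fun x _ => (hf x).differentiableAt
    · exact fun x _ => hh.differentiable one_ne_zero x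
  have hsum : ∀ x, fderiv ℝ h x x = ∑ i, x i * fderiv ℝ h x (e i) := fun x => by
    have hx : fderiv ℝ h x (∑ i, e.repr x i • e i) = ∑ i, x i * fderiv ℝ h x (e i) := by
      simp only [map_sum, map_smul, smul_eq_mul]
      rfl
    rwa [e.sum_repr x] at hx
  simp_rw [hsum]
  rw [integral_add (hint.const_mul _) (integrable_finsetSum _ fun i _ => hint_i i),
    integral_finsetSum _ fun i _ => hint_i i, integral_const_mul]
  simp [hparts]

theorem contDiff_abs_pow (hN : 2 ≤ N) : ContDiff ℝ 1 fun t : ℝ => |t| ^ N := by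
  have h := contDiff_norm_rpow (E := ℝ) (p := N) (by exact_mod_cast hN)
  simpa [Real.rpow_natCast] using h

theorem hasDerivAt_abs_pow (hN : 2 ≤ N) (t : ℝ) :
    HasDerivAt (fun t : ℝ => |t| ^ N) (N * (|t| ^ (N - 2) * t)) t := by
  have h := hasDerivAt_abs_rpow t (p := N) (by exact_mod_cast hN)
  have h2 : (N : ℝ) - 2 = ((N - 2 : ℕ) : ℝ) := by push_cast [Nat.cast_sub hN]; ring
  rw [h2] at h
  simpa [Real.rpow_natCast, mul_assoc] using h

/-- The radial weight `|x|^{-N} B(log (R / |x|))`. -/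
noncomputable def radialWeight (N : ℕ) (R : ℝ) (B : ℝ → ℝ) (x : EuclideanSpace ℝ (Fin N)) : ℝ :=
  (‖x‖ ^ N)⁻¹ * B (Real.log (R / ‖x‖))

theorem radialWeight_zero (hN : 2 ≤ N) (R : ℝ) (B : ℝ → ℝ) :
    radialWeight N R B 0 = 0 := by
  simp [radialWeight, show N ≠ 0 by omega]

theorem log_div_norm_pos {R : ℝ} {x : EuclideanSpace ℝ (Fin N)} (hx0 : x ≠ 0) (hx : ‖x‖ < R) :
    0 < Real.log (R / ‖x‖) :=
  Real.log_pos ((one_lt_div (norm_pos_iff.2 hx0)).2 hx)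

/-- Large `τ` means small `|x|`, so a profile `B` vanishing beyond `T` switches off the singularity
at the origin. -/
theorem eventually_radialWeight_eq_zero (hN : 2 ≤ N) {R : ℝ} (hR : 0 < R) {B : ℝ → ℝ} {T : ℝ}
    (hT : ∀ τ, T < τ → B τ = 0) :
    ∀ᶠ x : EuclideanSpace ℝ (Fin N) in 𝓝 0, radialWeight N R B x = 0 := by
  have : ball (0 : EuclideanSpace ℝ (Fin N)) (R * Real.exp (-T)) ∈ 𝓝 0 :=
    ball_mem_nhds _ (by positivity)
  filter_upwards [this] with x hx
  rcases eq_or_ne x 0 with rfl | hx0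
  · exact radialWeight_zero hN R B
  · have hn := norm_pos_iff.2 hx0
    rw [mem_ball_zero_iff] at hx
    have : T < Real.log (R / ‖x‖) := by
      rw [Real.lt_log_iff_exp_lt (by positivity), lt_div_iff₀ hn]
      calc Real.exp T * ‖x‖ < Real.exp T * (R * Real.exp (-T)) := by gcongr
        _ = R * (Real.exp T * Real.exp (-T)) := by ring
        _ = R := by rw [← Real.exp_add]; simp
    simp [radialWeight, hT _ this]

theorem contDiffAt_log_div_norm {n : WithTop ℕ∞} {R : ℝ} (hR : 0 < R)
    {x : EuclideanSpace ℝ (Fin N)} (hx0 : x ≠ 0) :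
    ContDiffAt ℝ n (fun x : EuclideanSpace ℝ (Fin N) => Real.log (R / ‖x‖)) x :=
  ContDiffAt.log (contDiffAt_const.div (contDiffAt_norm ℝ hx0) (norm_ne_zero_iff.2 hx0))
    (div_pos hR (norm_pos_iff.2 hx0)).ne'

theorem contDiffAt_radialWeight {R : ℝ} (hR : 0 < R) {B : ℝ → ℝ}
    (hB : ContDiffOn ℝ 1 B (Ioi 0)) {x : EuclideanSpace ℝ (Fin N)} (hx0 : x ≠ 0)
    (hx : ‖x‖ < R) : ContDiffAt ℝ 1 (radialWeight N R B) x := by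
  refine ContDiffAt.mul ?_ ?_
  · exact ((contDiffAt_norm ℝ hx0).pow N).inv (pow_ne_zero _ (norm_ne_zero_iff.2 hx0))
  · exact ContDiffAt.comp (g := B) x
      (hB.contDiffAt (Ioi_mem_nhds (log_div_norm_pos hx0 hx))) (contDiffAt_log_div_norm hR hx0)

/-- Euler's relation: `|x|^{-N}` is homogeneous of degree `-N`, and `log (R / |x|)` drops at unit
rate in `log |x|`. The first term is what cancels the dimension in the divergence identity. -/
theorem fderiv_radialWeight_self {R : ℝ} (hR : 0 < R) {B : ℝ → ℝ}
    (hB : ContDiffOn ℝ 1 B (Ioi 0)) {x : EuclideanSpace ℝ (Fin N)} (hx0 : x ≠ 0)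
    (hx : ‖x‖ < R) :
    fderiv ℝ (radialWeight N R B) x x
      = -(N * radialWeight N R B x) - radialWeight N R (deriv B) x := by
  have hn : 0 < ‖x‖ := norm_pos_iff.2 hx0
  have hlog := log_div_norm_pos hx0 hx
  have hBd : HasDerivAt B (deriv B (Real.log (R / ‖x‖))) (Real.log (R / ‖x‖)) :=
    ((hB.contDiffAt (Ioi_mem_nhds hlog)).differentiableAt one_ne_zero).hasDerivAt
  have h1 : HasDerivAt (fun r : ℝ => Real.log (R / r)) (-‖x‖⁻¹) ‖x‖ := by
    have := ((hasDerivAt_const ‖x‖ R).div (hasDerivAt_id ‖x‖) hn.ne').log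
      (div_pos hR hn).ne'
    refine HasDerivAt.congr_deriv (f := fun r : ℝ => Real.log (R / r)) this ?_
    symm
    change -‖x‖⁻¹ = (0 * ‖x‖ - R * 1) / ‖x‖ ^ 2 / (R / ‖x‖)
    field_simp
    ring
  have h2 : HasDerivAt (fun r : ℝ => B (Real.log (R / r)))
      (deriv B (Real.log (R / ‖x‖)) * (-‖x‖⁻¹)) ‖x‖ := HasDerivAt.comp (h₂ := B) _ hBd h1
  have h3 : HasDerivAt (fun r : ℝ => (r ^ N)⁻¹) (-(N * ‖x‖ ^ (N - 1)) / (‖x‖ ^ N) ^ 2) ‖x‖ :=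
    (hasDerivAt_pow N ‖x‖).inv (pow_ne_zero _ hn.ne')
  have h4 : DifferentiableAt ℝ (fun x : EuclideanSpace ℝ (Fin N) => ‖x‖) x :=
    (contDiffAt_norm ℝ hx0 (n := 1)).differentiableAt one_ne_zero
  have h5 := (h3.mul h2).comp_hasFDerivAt x h4.hasFDerivAt
  have h6 : fderiv ℝ (radialWeight N R B) x = _ := h5.fderiv
  rw [h6, _root_.smul_apply, h4.fderiv_norm_self]
  simp only [radialWeight, smul_eq_mul]
  rcases Nat.eq_zero_or_pos N with rfl | hNpos
  · simp
    field_simp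
  · obtain ⟨m, rfl⟩ : ∃ m, N = m + 1 := ⟨N - 1, by omega⟩
    simp only [Nat.add_sub_cancel, pow_succ]
    field_simp
    ring

theorem continuous_mul_radialWeight (hN : 2 ≤ N) {R : ℝ} (hR : 0 < R)
    {ψ : EuclideanSpace ℝ (Fin N) → ℝ} (hψ : Continuous ψ) (hsupp : tsupport ψ ⊆ ball 0 R)
    {B : ℝ → ℝ} (hB : ContinuousOn B (Ioi 0)) {T : ℝ} (hT : ∀ τ, T < τ → B τ = 0) :
    Continuous fun x => ψ x * radialWeight N R B x := by
  rw [continuous_iff_continuousAt]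
  intro x
  by_cases hx : x ∈ tsupport ψ
  · have hxR : ‖x‖ < R := by simpa using hsupp hx
    rcases eq_or_ne x 0 with rfl | hx0
    · refine (continuousAt_const (y := (0 : ℝ))).congr ?_
      filter_upwards [eventually_radialWeight_eq_zero hN hR hT] with y hy
      simp [hy]
    · refine hψ.continuousAt.mul (ContinuousAt.mul ?_ ?_)
      · exact (continuous_norm.continuousAt.pow N).inv₀ (pow_ne_zero _ (norm_ne_zero_iff.2 hx0))
      · exact ContinuousAt.comp (g := B)
          (hB.continuousAt (Ioi_mem_nhds (log_div_norm_pos hx0 hxR)))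
          (contDiffAt_log_div_norm (n := 0) hR hx0).continuousAt
  · refine (continuousAt_const (y := (0 : ℝ))).congr ?_
    filter_upwards [notMem_tsupport_iff_eventuallyEq.1 hx] with y hy
    simp [hy]

theorem integrable_mul_radialWeight (hN : 2 ≤ N) {R : ℝ} (hR : 0 < R)
    {ψ : EuclideanSpace ℝ (Fin N) → ℝ} (hψ : Continuous ψ) (hc : HasCompactSupport ψ)
    (hsupp : tsupport ψ ⊆ ball 0 R)
    {B : ℝ → ℝ} (hB : ContinuousOn B (Ioi 0)) {T : ℝ} (hT : ∀ τ, T < τ → B τ = 0) :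
    Integrable fun x => ψ x * radialWeight N R B x :=
  (continuous_mul_radialWeight hN hR hψ hsupp hB hT).integrable_of_hasCompactSupport hc.mul_right

theorem deriv_eq_zero_of_eventually_zero {B : ℝ → ℝ} {T : ℝ} (hT : ∀ τ, T < τ → B τ = 0) :
    ∀ τ, T < τ → deriv B τ = 0 := fun τ hτ => by
  have : B =ᶠ[𝓝 τ] fun _ => 0 := by
    filter_upwards [Ioi_mem_nhds hτ] with t ht using hT t ht
  simp [this.deriv_eq]

theorem tsupport_abs_pow_subset {φ : EuclideanSpace ℝ (Fin N) → ℝ} (hN : 2 ≤ N) :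
    tsupport (fun x => |φ x| ^ N) ⊆ tsupport φ := by
  refine closure_mono fun x hx => ?_
  contrapose! hx
  simp only [Function.mem_support, not_not] at hx ⊢
  simp [hx, show N ≠ 0 by omega]

/-- This is the divergence identity for `h = |φ|^N |x|^{-N} B`. The support of `φ` avoids the sphere
`τ = 0` and the vanishing of `B` beyond `T` avoids the origin, so `h` is `C^1` on the whole space.
-/
theorem integral_test_radialWeight (hN : 2 ≤ N) {R : ℝ} (hR : 0 < R)
    {φ : EuclideanSpace ℝ (Fin N) → ℝ} (hφ : IsTestFunction (ball 0 R) φ)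
    {B : ℝ → ℝ} (hB : ContDiffOn ℝ 1 B (Ioi 0)) {T : ℝ} (hT : ∀ τ, T < τ → B τ = 0) :
    ∫ x, (N * (|φ x| ^ (N - 2) * φ x * fderiv ℝ φ x x) * radialWeight N R B x
      - |φ x| ^ N * radialWeight N R (deriv B) x) = 0 := by
  obtain ⟨hsm, hc, hsupp⟩ := hφ
  have hsm1 : ContDiff ℝ 1 φ := hsm.of_le (by exact_mod_cast le_top)
  have habs : ContDiff ℝ 1 fun x => |φ x| ^ N := (contDiff_abs_pow hN).comp hsm1
  have hh : ContDiff ℝ 1 fun x => |φ x| ^ N * radialWeight N R B x := by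
    rw [contDiff_iff_contDiffAt]
    intro x
    by_cases hx : x ∈ tsupport φ
    · have hxR : ‖x‖ < R := by simpa using hsupp hx
      rcases eq_or_ne x 0 with rfl | hx0
      · refine (contDiffAt_const (c := (0 : ℝ))).congr_of_eventuallyEq ?_
        filter_upwards [eventually_radialWeight_eq_zero hN hR hT] with y hy
        simp [hy]
      · exact habs.contDiffAt.mul (contDiffAt_radialWeight hR hB hx0 hxR)
    · refine (contDiffAt_const (c := (0 : ℝ))).congr_of_eventuallyEq ?_
      filter_upwards [notMem_tsupport_iff_eventuallyEq.1 hx] with y hy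
      simp [hy, show N ≠ 0 by omega]
  have hcomp : HasCompactSupport fun x => |φ x| ^ N * radialWeight N R B x :=
    HasCompactSupport.mul_right (hc.comp_left (g := fun t : ℝ => |t| ^ N)
      (by simp [show N ≠ 0 by omega]))
  rw [← integral_dim_mul_add_fderiv_self hh hcomp]
  congr 1 with x
  rcases eq_or_ne x 0 with rfl | hx0
  · simp [radialWeight_zero hN]
  by_cases hx : x ∈ tsupport φ
  · have hxR : ‖x‖ < R := by simpa using hsupp hx
    have h1 : HasFDerivAt (fun x => |φ x| ^ N) _ x :=
      (hasDerivAt_abs_pow hN (φ x)).comp_hasFDerivAt x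
        (hsm1.differentiable one_ne_zero x).hasFDerivAt
    have h2 := ((contDiffAt_radialWeight hR hB hx0 hxR).differentiableAt one_ne_zero).hasFDerivAt
    have h3 : HasFDerivAt (fun x => |φ x| ^ N * radialWeight N R B x) _ x := h1.mul h2
    rw [h3.fderiv]
    simp only [add_apply, _root_.smul_apply, smul_eq_mul, fderiv_radialWeight_self hR hB hx0 hxR]
    ring
  · have h0 := notMem_tsupport_iff_eventuallyEq.1 hx
    have h1 : (fun x => |φ x| ^ N * radialWeight N R B x) =ᶠ[𝓝 x] fun _ => 0 := by
      filter_upwards [h0] with y hy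
      simp [hy, show N ≠ 0 by omega]
    rw [h1.fderiv_eq, h0.self_of_nhds]
    simp [show N ≠ 0 by omega]

/-! ### Young's inequality and the pointwise Hardy estimate -/

/-- Bernoulli's inequality for `(b / a) ^ N`, multiplied by `a ^ N`. -/
theorem nat_young (hN : 2 ≤ N) {a b : ℝ} (ha : 0 ≤ a) (hb : 0 ≤ b) :
    N * (a ^ (N - 1) * b) ≤ (N - 1) * a ^ N + b ^ N := by
  rcases ha.eq_or_lt with rfl | ha
  · simp [show N - 1 ≠ 0 by omega, show N ≠ 0 by omega]; positivity
  · have h := one_add_mul_le_pow (a := b / a - 1) (by have := div_nonneg hb ha.le; linarith) N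
    obtain ⟨m, rfl⟩ : ∃ m, N = m + 1 := ⟨N - 1, by omega⟩
    have h2 := mul_le_mul_of_nonneg_right h (pow_nonneg ha.le (m + 1))
    rw [add_sub_cancel, div_pow, div_mul_cancel₀ _ (pow_ne_zero _ ha.ne')] at h2
    have h3 : (1 + ((m + 1 : ℕ) : ℝ) * (b / a - 1)) * a ^ (m + 1)
        = (m + 1 : ℕ) * (a ^ m * b) - ((m + 1 : ℕ) - 1) * a ^ (m + 1) := by
      rw [pow_succ]; field_simp; ring
    simp only [Nat.add_sub_cancel]
    linarith

/-- Bernoulli's inequality is strict away from `b / a = 1`. -/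
theorem eq_of_nat_young_eq (hN : 2 ≤ N) {a b : ℝ} (ha : 0 ≤ a) (hb : 0 ≤ b)
    (h : (N - 1) * a ^ N + b ^ N ≤ N * (a ^ (N - 1) * b)) : b = a := by
  rcases ha.eq_or_lt with rfl | ha
  · simp only [ne_eq, show N ≠ 0 by omega, not_false_eq_true, zero_pow, mul_zero, zero_add,
      show N - 1 ≠ 0 by omega, zero_mul] at h
    exact pow_eq_zero_iff (show N ≠ 0 by omega) |>.1 (le_antisymm h (by positivity))
  · by_contra hne
    have hs : b / a - 1 ≠ 0 := by
      rw [sub_ne_zero, ne_eq, div_eq_one_iff_eq ha.ne']; exact hne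
    have h1 := one_add_mul_self_lt_rpow_one_add (s := b / a - 1)
      (by have := div_nonneg hb ha.le; linarith) hs (p := N) (by exact_mod_cast (by omega : 1 < N))
    rw [Real.rpow_natCast] at h1
    obtain ⟨m, rfl⟩ : ∃ m, N = m + 1 := ⟨N - 1, by omega⟩
    have h2 := mul_lt_mul_of_pos_right h1 (pow_pos ha (m + 1))
    rw [add_sub_cancel, div_pow, div_mul_cancel₀ _ (pow_ne_zero _ ha.ne')] at h2
    have h3 : (1 + ((m + 1 : ℕ) : ℝ) * (b / a - 1)) * a ^ (m + 1)
        = (m + 1 : ℕ) * (a ^ m * b) - ((m + 1 : ℕ) - 1) * a ^ (m + 1) := by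
      rw [pow_succ]; field_simp; ring
    simp only [Nat.add_sub_cancel] at h
    linarith

theorem norm_gradient_eq {E : Type*} [NormedAddCommGroup E] [InnerProductSpace ℝ E]
    [CompleteSpace E] (φ : E → ℝ) (x : E) : ‖gradient φ x‖ = ‖fderiv ℝ φ x‖ := by
  simp [gradient]

theorem abs_cross_term_le (hN : 2 ≤ N) {n τ v G d : ℝ} (hn : 0 < n) (hτ : 0 < τ)
    (hd : |d| ≤ G * n) :
    |(|v| ^ (N - 2) * v * d) * ((n ^ N)⁻¹ * (τ ^ (N - 1))⁻¹)| ≤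
      (|v| / (n * τ)) ^ (N - 1) * G := by
  obtain ⟨m, rfl⟩ : ∃ m, N = m + 2 := ⟨N - 2, by omega⟩
  simp only [Nat.add_sub_cancel, show m + 2 - 1 = m + 1 by omega]
  rw [abs_mul, abs_mul, abs_mul, abs_of_nonneg (pow_nonneg (abs_nonneg v) m),
    abs_of_nonneg (a := (n ^ (m + 2))⁻¹ * (τ ^ (m + 1))⁻¹) (by positivity)]
  calc |v| ^ m * |v| * |d| * ((n ^ (m + 2))⁻¹ * (τ ^ (m + 1))⁻¹)
      ≤ |v| ^ m * |v| * (G * n) * ((n ^ (m + 2))⁻¹ * (τ ^ (m + 1))⁻¹) := by gcongr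
    _ = (|v| / (n * τ)) ^ (m + 1) * G := by
      rw [div_pow, mul_pow, pow_succ n (m + 1), pow_succ |v| m]; field_simp

theorem abs_pow_mul_inv_pow (n τ v : ℝ) :
    |v| ^ N * ((n ^ N)⁻¹ * (τ ^ N)⁻¹) = (|v| / (n * τ)) ^ N := by
  rw [div_pow, mul_pow, div_eq_mul_inv, mul_inv]

/-- The integrand of the Hardy functional dominates, up to the factor `S`, the expression which
integrates to zero. -/
theorem hardy_pointwise (hN : 2 ≤ N) {α n τ S v G d : ℝ} (hα : 0 < α) (hNα : N * α = N - 1)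
    (hn : 0 < n) (hτ : 0 < τ) (hS0 : 0 ≤ S) (hS1 : S ≤ 1) (hG : 0 ≤ G) (hd : |d| ≤ G * n) :
    α ^ N * (|v| ^ N * ((n ^ N)⁻¹ * ((τ ^ N)⁻¹ * S))) - G ^ N ≤
      α ^ (N - 1) * (N * (|v| ^ (N - 2) * v * d) * ((n ^ N)⁻¹ * ((τ ^ (N - 1))⁻¹ * S))
        + (N - 1) * (|v| ^ N * ((n ^ N)⁻¹ * ((τ ^ N)⁻¹ * S)))) := by
  obtain ⟨m, rfl⟩ : ∃ m, N = m + 2 := ⟨N - 2, by omega⟩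
  simp only [Nat.add_sub_cancel, show m + 2 - 1 = m + 1 by omega] at *
  set A := |v| / (n * τ) with hA
  have hA0 : 0 ≤ A := by positivity
  have h1 : |v| ^ (m + 2) * ((n ^ (m + 2))⁻¹ * ((τ ^ (m + 2))⁻¹ * S)) = A ^ (m + 2) * S := by
    rw [hA, ← abs_pow_mul_inv_pow]; ring
  have h2 : -(A ^ (m + 1) * G * S) ≤
      (|v| ^ m * v * d) * ((n ^ (m + 2))⁻¹ * ((τ ^ (m + 1))⁻¹ * S)) := by
    have h3 := (abs_le.1 (abs_cross_term_le (N := m + 2) (by omega) (v := v) hn hτ hd)).1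
    simp only [Nat.add_sub_cancel, show m + 2 - 1 = m + 1 by omega, ← hA] at h3
    have h4 := mul_le_mul_of_nonneg_right h3 hS0
    linarith
  rw [h1]
  -- Scaling `A` by `α` is the optimal choice: `s = α` maximizes `(N - 1) (s ^ (N - 1) - s ^ N)`,
  -- and the maximum is `α ^ N`.
  have hy := nat_young (N := m + 2) (by omega) (a := α * A) (b := G) (by positivity) hG
  simp only [show m + 2 - 1 = m + 1 by omega] at hy
  set c : ℝ := ((m + 2 : ℕ) : ℝ) with hc
  have hc0 : 0 ≤ c := by positivity
  have h4 := mul_le_mul_of_nonneg_left h2 (show 0 ≤ α ^ (m + 1) * c by positivity)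
  have h5 := mul_le_mul_of_nonneg_right hy hS0
  have h6 : G ^ (m + 2) * S ≤ G ^ (m + 2) := mul_le_of_le_one_right (by positivity) hS1
  rw [mul_pow, mul_pow] at h5
  have h7 : α ^ (m + 2) = α ^ (m + 1) * α := pow_succ _ _
  have h8 : (c - 1) * (α ^ (m + 2) * A ^ (m + 2)) * S
      = α ^ (m + 1) * (c - 1) * (A ^ (m + 2) * S) - α ^ (m + 2) * (A ^ (m + 2) * S) := by
    rw [h7]; linear_combination (α ^ (m + 1) * A ^ (m + 2) * S) * hNα
  nlinarith

/-! ### The Hardy inequality for test functions -/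

theorem weight_eq_radialWeight (R : ℝ) (x : EuclideanSpace ℝ (Fin N)) :
    weight R x = radialWeight N R (fun τ => (τ ^ N)⁻¹) x := by
  rw [weight, radialWeight, one_div, mul_inv]

theorem monotone_smoothTransition_deriv_nonneg (t : ℝ) : 0 ≤ deriv Real.smoothTransition t :=
  Real.smoothTransition.monotone.deriv_nonneg

theorem contDiffOn_inv_pow (k : ℕ) {n : WithTop ℕ∞} :
    ContDiffOn ℝ n (fun τ : ℝ => (τ ^ k)⁻¹) (Ioi 0) :=
  (contDiff_id.pow k).contDiffOn.inv fun _ hτ => pow_ne_zero _ (ne_of_gt hτ)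

theorem hasDerivAt_inv_pow_pred (hN : 2 ≤ N) {τ : ℝ} (hτ : 0 < τ) :
    HasDerivAt (fun τ : ℝ => (τ ^ (N - 1))⁻¹) (-((N - 1) * (τ ^ N)⁻¹)) τ := by
  obtain ⟨m, rfl⟩ : ∃ m, N = m + 2 := ⟨N - 2, by omega⟩
  refine ((hasDerivAt_pow (m + 1) τ).inv (pow_ne_zero _ hτ.ne')).congr_deriv ?_
  push_cast [show m + 2 - 1 = m + 1 by omega, Nat.add_sub_cancel]
  field_simp
  ring

theorem IsTestFunction.mono {Ω Ω' : Set (EuclideanSpace ℝ (Fin N))}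
    {φ : EuclideanSpace ℝ (Fin N) → ℝ} (hφ : IsTestFunction Ω φ) (h : Ω ⊆ Ω') :
    IsTestFunction Ω' φ := ⟨hφ.1, hφ.2.1, hφ.2.2.trans h⟩

theorem integrable_test_radialWeight (hN : 2 ≤ N) {R : ℝ} (hR : 0 < R)
    {φ : EuclideanSpace ℝ (Fin N) → ℝ} (hφ : IsTestFunction (ball 0 R) φ)
    {B : ℝ → ℝ} (hB : ContDiffOn ℝ 1 B (Ioi 0)) {T : ℝ} (hT : ∀ τ, T < τ → B τ = 0) :
    (Integrable fun x => N * (|φ x| ^ (N - 2) * φ x * fderiv ℝ φ x x) * radialWeight N R B x) ∧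
      Integrable fun x => |φ x| ^ N * radialWeight N R (deriv B) x := by
  obtain ⟨hsm, hc, hsupp⟩ := id hφ
  have hsm1 : ContDiff ℝ 1 φ := hsm.of_le (by exact_mod_cast le_top)
  have hN0 : N ≠ 0 := by omega
  constructor
  · have hsub : tsupport (fun x => (N : ℝ) * (|φ x| ^ (N - 2) * φ x * fderiv ℝ φ x x)) ⊆
        tsupport φ := by
      refine closure_mono fun x hx => ?_
      contrapose! hx
      simp only [Function.mem_support, not_not] at hx ⊢
      simp [hx]
    have hcf := hsm1.continuous_fderiv one_ne_zero
    have hcφ := hsm1.continuous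
    exact integrable_mul_radialWeight hN hR (by fun_prop)
      (hc.mono' ((subset_tsupport _).trans hsub)) (hsub.trans hsupp) hB.continuousOn hT
  · exact integrable_mul_radialWeight hN hR (hsm1.continuous.abs.pow N)
      (hc.comp_left (g := fun t : ℝ => |t| ^ N) (by simp [hN0]))
      ((tsupport_abs_pow_subset hN).trans hsupp)
      (hB.continuousOn_deriv_of_isOpen isOpen_Ioi le_rfl)
      (deriv_eq_zero_of_eventually_zero hT)

/-- The ideal profile `τ^{1-N}` does not vanish for large `τ`, so it is cut off at `T`. The factor
`S (T - τ)` is decreasing, so its derivative enters with the favourable sign and may be dropped. -/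
theorem hardy_test_truncated (hN : 2 ≤ N) {R : ℝ} (hR : 0 < R)
    {φ : EuclideanSpace ℝ (Fin N) → ℝ} (hφ : IsTestFunction (ball 0 R) φ) (T : ℝ) :
    (((N : ℝ) - 1) / N) ^ N * ∫ x, |φ x| ^ N *
        radialWeight N R (fun τ => (τ ^ N)⁻¹ * Real.smoothTransition (T - τ)) x ≤
      ∫ x, ‖gradient φ x‖ ^ N := by
  obtain ⟨hsm, hc, hsupp⟩ := id hφ
  have hsm1 : ContDiff ℝ 1 φ := hsm.of_le (by exact_mod_cast le_top)
  have hN0 : N ≠ 0 := by omega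
  have hNpos : (0 : ℝ) < N := by positivity
  have hN1 : (0 : ℝ) < N - 1 := by
    have : (2 : ℝ) ≤ N := by exact_mod_cast hN
    linarith
  set α : ℝ := ((N : ℝ) - 1) / N with hα
  have hα0 : 0 < α := by positivity
  have hNα : N * α = N - 1 := by rw [hα]; field_simp
  set S := Real.smoothTransition with hS
  have hSd : ContDiff ℝ 1 fun τ : ℝ => S (T - τ) :=
    Real.smoothTransition.contDiff.comp (contDiff_const.sub contDiff_id)
  set B : ℝ → ℝ := fun τ => (τ ^ (N - 1))⁻¹ * S (T - τ) with hB
  have hBd : ContDiffOn ℝ 1 B (Ioi 0) := (contDiffOn_inv_pow _).mul hSd.contDiffOn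
  have hzero : ∀ τ, T < τ → S (T - τ) = 0 := fun τ hτ =>
    Real.smoothTransition.zero_of_nonpos (by linarith)
  have hBT : ∀ τ, T < τ → B τ = 0 := fun τ hτ => by simp [hB, hzero τ hτ]
  have hid := integral_test_radialWeight hN hR hφ hBd hBT
  have hderiv : ∀ τ, 0 < τ → (N - 1) * ((τ ^ N)⁻¹ * S (T - τ)) ≤ -deriv B τ := fun τ hτ => by
    have h1 : HasDerivAt (fun τ => S (T - τ)) (-deriv S (T - τ)) τ :=
      HasDerivAt.comp_const_sub T τ
        ((Real.smoothTransition.contDiff (n := 1)).differentiable one_ne_zero _).hasDerivAt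
    have h2 : HasDerivAt B _ τ := (hasDerivAt_inv_pow_pred hN hτ).mul h1
    rw [h2.deriv]
    have : 0 ≤ (τ ^ (N - 1))⁻¹ * deriv S (T - τ) :=
      mul_nonneg (by positivity) (monotone_smoothTransition_deriv_nonneg _)
    linarith
  have hφN : Continuous fun x => |φ x| ^ N := hsm1.continuous.abs.pow N
  have hφc : HasCompactSupport fun x => |φ x| ^ N :=
    hc.comp_left (g := fun t : ℝ => |t| ^ N) (by simp [hN0])
  have hφs : tsupport (fun x => |φ x| ^ N) ⊆ ball 0 R := (tsupport_abs_pow_subset hN).trans hsupp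
  have hint1 : Integrable fun x => |φ x| ^ N *
      radialWeight N R (fun τ => (τ ^ N)⁻¹ * S (T - τ)) x :=
    integrable_mul_radialWeight hN hR hφN hφc hφs
      (((contDiffOn_inv_pow (n := 1) N).mul hSd.contDiffOn).continuousOn)
      (T := T) fun τ hτ => by simp [hzero τ hτ]
  obtain ⟨hint3, hint2⟩ := integrable_test_radialWeight hN hR hφ hBd hBT
  have hint4 : Integrable fun x => ‖gradient φ x‖ ^ N := by
    simp_rw [norm_gradient_eq]
    refine Continuous.integrable_of_hasCompactSupport
      ((hsm1.continuous_fderiv one_ne_zero).norm.pow N) ?_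
    exact (hc.fderiv ℝ).comp_left (g := fun L : EuclideanSpace ℝ (Fin N) →L[ℝ] ℝ => ‖L‖ ^ N)
      (by simp [hN0])
  rw [← integral_const_mul, ← sub_nonpos, ← integral_sub (hint1.const_mul _) hint4,
    ← mul_zero (α ^ (N - 1)), ← hid, ← integral_const_mul]
  refine integral_mono ((hint1.const_mul _).sub hint4) ((hint3.sub hint2).const_mul _) fun x => ?_
  by_cases hx : x ≠ 0 ∧ x ∈ tsupport φ
  · obtain ⟨hx0, hx⟩ := hx
    have hxR : ‖x‖ < R := by simpa using hsupp hx
    have hτ := log_div_norm_pos hx0 hxR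
    have hp := hardy_pointwise hN hα0 hNα (norm_pos_iff.2 hx0) hτ
      (Real.smoothTransition.nonneg (T - Real.log (R / ‖x‖))) (Real.smoothTransition.le_one _)
      (norm_nonneg (gradient φ x)) (v := φ x) (d := fderiv ℝ φ x x)
      (by rw [norm_gradient_eq]; exact (fderiv ℝ φ x).le_opNorm x)
    refine hp.trans (mul_le_mul_of_nonneg_left ?_ (by positivity))
    have h5 := mul_le_mul_of_nonneg_left (hderiv _ hτ)
      (show 0 ≤ |φ x| ^ N * (‖x‖ ^ N)⁻¹ by positivity)
    simp only [radialWeight, hB] at h5 ⊢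
    linarith
  · have : (x = 0) ∨ φ x = 0 := by
      by_contra! h
      exact hx ⟨h.1, subset_tsupport _ h.2⟩
    rcases this with rfl | h0
    · simp [radialWeight_zero hN]
    · simp [h0, hN0]

/-- The truncation is removed by Fatou's lemma; at each point it is inactive once `T` exceeds `log
(R / |x|) + 1`. -/
theorem hardy_test (hN : 2 ≤ N) {R : ℝ} (hR : 0 < R)
    {φ : EuclideanSpace ℝ (Fin N) → ℝ} (hφ : IsTestFunction (ball 0 R) φ) :
    ENNReal.ofReal ((((N : ℝ) - 1) / N) ^ N) * ∫⁻ x, ENNReal.ofReal (weight R x * |φ x| ^ N) ≤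
      ∫⁻ x, ENNReal.ofReal (‖gradient φ x‖ ^ N) := by
  obtain ⟨hsm, hc, hsupp⟩ := id hφ
  have hsm1 : ContDiff ℝ 1 φ := hsm.of_le (by exact_mod_cast le_top)
  have hN0 : N ≠ 0 := by omega
  have hN1 : (0 : ℝ) < N - 1 := by
    have : (2 : ℝ) ≤ N := by exact_mod_cast hN
    linarith
  have hα0 : 0 ≤ (((N : ℝ) - 1) / N) ^ N := by positivity
  set S := Real.smoothTransition with hS
  set w : ℕ → EuclideanSpace ℝ (Fin N) → ℝ := fun T x => |φ x| ^ N *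
        radialWeight N R (fun τ => (τ ^ N)⁻¹ * S (T - τ)) x with hw
  have hwc : ∀ T, Continuous (w T) := fun T =>
    continuous_mul_radialWeight hN hR (hsm1.continuous.abs.pow N)
      ((tsupport_abs_pow_subset hN).trans hsupp) (T := T)
      (((contDiffOn_inv_pow (n := 1) N).mul
        (Real.smoothTransition.contDiff.comp (contDiff_const.sub contDiff_id)).contDiffOn
          ).continuousOn)
      fun τ hτ => by
        simp [hS, Real.smoothTransition.zero_of_nonpos (show (T : ℝ) - τ ≤ 0 by linarith)]
  have hw0 : ∀ T x, 0 ≤ w T x := fun T x => by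
    by_cases hx : x ≠ 0 ∧ x ∈ tsupport φ
    · obtain ⟨hx0, hx⟩ := hx
      have hxR : ‖x‖ < R := by simpa using hsupp hx
      have hτ := log_div_norm_pos hx0 hxR
      have := Real.smoothTransition.nonneg (T - Real.log (R / ‖x‖))
      simp only [hw, radialWeight]
      positivity
    · have : (x = 0) ∨ φ x = 0 := by
        by_contra! h
        exact hx ⟨h.1, subset_tsupport _ h.2⟩
      rcases this with rfl | h0
      · simp [hw, radialWeight_zero hN]
      · simp [hw, h0, hN0]
  have hwlim : ∀ x, Tendsto (fun T => ENNReal.ofReal (w T x)) atTop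
      (𝓝 (ENNReal.ofReal (weight R x * |φ x| ^ N))) := fun x => by
    refine tendsto_const_nhds.congr' ?_
    filter_upwards [eventually_ge_atTop ⌈Real.log (R / ‖x‖) + 1⌉₊] with T hT
    have h1 : 1 ≤ (T : ℝ) - Real.log (R / ‖x‖) := by
      have := Nat.ceil_le.1 hT
      linarith
    simp only [hw, weight_eq_radialWeight, radialWeight, hS,
      Real.smoothTransition.one_of_one_le h1, mul_one]
    rw [mul_comm]
  have hfin : ∀ T, ENNReal.ofReal ((((N : ℝ) - 1) / N) ^ N) * ∫⁻ x, ENNReal.ofReal (w T x) ≤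
      ∫⁻ x, ENNReal.ofReal (‖gradient φ x‖ ^ N) := fun T => by
    have hcw : HasCompactSupport (w T) := HasCompactSupport.mul_right
      (hc.comp_left (g := fun t : ℝ => |t| ^ N) (by simp [hN0]))
    have hint4 : Integrable fun x => ‖gradient φ x‖ ^ N := by
      simp_rw [norm_gradient_eq]
      refine Continuous.integrable_of_hasCompactSupport
        ((hsm1.continuous_fderiv one_ne_zero).norm.pow N) ?_
      exact (hc.fderiv ℝ).comp_left (g := fun L : EuclideanSpace ℝ (Fin N) →L[ℝ] ℝ => ‖L‖ ^ N)
        (by simp [hN0])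
    rw [← ofReal_integral_eq_lintegral_ofReal
      ((hwc T).integrable_of_hasCompactSupport hcw) (Eventually.of_forall (hw0 T)),
      ← ofReal_integral_eq_lintegral_ofReal hint4 (Eventually.of_forall fun x => by positivity),
      ← ENNReal.ofReal_mul hα0]
    exact ENNReal.ofReal_le_ofReal (hardy_test_truncated hN hR hφ T)
  have hfatou : ∫⁻ x, ENNReal.ofReal (weight R x * |φ x| ^ N) ≤
      liminf (fun T => ∫⁻ x, ENNReal.ofReal (w T x)) atTop := by
    refine le_trans (le_of_eq ?_) (lintegral_liminf_le fun T => (hwc T).measurable.ennreal_ofReal)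
    exact lintegral_congr fun x => (hwlim x).liminf_eq.symm
  rcases hα0.eq_or_lt with h0 | h0
  · simp [← h0]
  rw [mul_comm, ← ENNReal.le_div_iff_mul_le (.inl (by simpa using h0)) (.inl ENNReal.ofReal_ne_top)]
  refine hfatou.trans (liminf_le_of_frequently_le' (Frequently.of_forall fun T => ?_))
  rw [ENNReal.le_div_iff_mul_le (.inl (by simpa using h0)) (.inl ENNReal.ofReal_ne_top), mul_comm]
  exact hfin T

/-! ### Passage from test functions to `W_0^{1,N}` -/

theorem eLpNorm_natCast_pow {α F : Type*} [MeasurableSpace α] {μ : Measure α}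
    [NormedAddCommGroup F] (hN : N ≠ 0) (f : α → F) :
    eLpNorm f (N : ℝ≥0∞) μ ^ N = ∫⁻ x, ‖f x‖ₑ ^ N ∂μ := by
  have h := eLpNorm_nnreal_pow_eq_lintegral (p := (N : NNReal)) (f := f) (μ := μ)
    (by exact_mod_cast hN)
  simpa [ENNReal.rpow_natCast] using h

/-- A sequence converging fast in `L^N` converges almost everywhere and is dominated in `L^N`. -/
theorem exists_dominating_of_eLpNorm_lt {α F : Type*} [MeasurableSpace α] {μ : Measure α}
    [NormedAddCommGroup F] (hN : N ≠ 0) {f : α → F} {fn : ℕ → α → F}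
    (hf : MemLp f (N : ℝ≥0∞) μ) (hfn : ∀ n, AEStronglyMeasurable (fn n) μ)
    (h : ∀ n, eLpNorm (fun x => f x - fn n x) (N : ℝ≥0∞) μ < (2⁻¹ : ℝ≥0∞) ^ n) :
    ∃ K : α → ℝ, Integrable K μ ∧ ∀ᵐ x ∂μ, Tendsto (fun n => fn n x) atTop (𝓝 (f x)) ∧
      ∀ n, ‖fn n x‖ ^ N ≤ K x := by
  -- The summed error powers are integrable by comparison with a geometric series. Where the sum is
  -- finite its terms tend to zero, which gives convergence, and each is at most the sum, which
  -- gives domination.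
  set S : α → ℝ≥0∞ := fun x => ∑' n, ‖f x - fn n x‖ₑ ^ N with hS
  have hmeas : ∀ n, AEMeasurable (fun x => ‖f x - fn n x‖ₑ ^ N) μ := fun n =>
    ((hf.1.sub (hfn n)).enorm).pow_const N
  have hSm : AEMeasurable S μ := AEMeasurable.tsum hmeas
  have hSint : ∫⁻ x, S x ∂μ ≠ ⊤ := by
    rw [lintegral_tsum hmeas]
    refine ne_top_of_le_ne_top (b := ∑' n, (2⁻¹ : ℝ≥0∞) ^ n) ?_ (ENNReal.tsum_le_tsum fun n => ?_)
    · rw [ENNReal.tsum_geometric, ENNReal.one_sub_inv_two, inv_inv]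
      exact ENNReal.ofNat_ne_top
    · rw [← eLpNorm_natCast_pow hN]
      have h1 : (2⁻¹ : ℝ≥0∞) ^ n ≤ 1 := pow_le_one₀ zero_le (by norm_num)
      calc _ ≤ ((2⁻¹ : ℝ≥0∞) ^ n) ^ N := by gcongr; exact (h n).le
        _ ≤ ((2⁻¹ : ℝ≥0∞) ^ n) ^ 1 := pow_le_pow_of_le_one zero_le h1 (by omega)
        _ = _ := pow_one _
  refine ⟨fun x => 2 ^ (N - 1) * (‖f x‖ ^ N + (S x).toReal), ?_, ?_⟩
  · refine Integrable.const_mul (Integrable.add ?_ (integrable_toReal_of_lintegral_ne_top hSm hSint)) _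
    have := hf.integrable_norm_pow (p := N) hN
    simpa using this
  · filter_upwards [ae_lt_top' hSm hSint] with x hx
    constructor
    · have h1 := ENNReal.tendsto_atTop_zero_of_tsum_ne_top hx.ne
      rw [tendsto_iff_edist_tendsto_0]
      have h2 : Tendsto (fun n => (‖f x - fn n x‖ₑ ^ N) ^ ((N : ℝ)⁻¹)) atTop (𝓝 0) := by
        have := (ENNReal.continuous_rpow_const (y := (N : ℝ)⁻¹)).tendsto 0 |>.comp h1
        rwa [ENNReal.zero_rpow_of_pos (by positivity)] at this
      refine h2.congr fun n => ?_
      rw [← ENNReal.rpow_natCast, ← ENNReal.rpow_mul, mul_inv_cancel₀ (by positivity),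
        ENNReal.rpow_one, edist_comm, edist_eq_enorm_sub]
    · intro n
      have h1 : ‖f x - fn n x‖ ^ N ≤ (S x).toReal := by
        rw [← toReal_enorm, ← ENNReal.toReal_pow]
        exact ENNReal.toReal_mono hx.ne (ENNReal.le_tsum n)
      have h2 : ‖fn n x‖ ≤ ‖f x‖ + ‖f x - fn n x‖ := by
        have := norm_sub_le (f x) (f x - fn n x)
        simpa using this
      calc ‖fn n x‖ ^ N ≤ (‖f x‖ + ‖f x - fn n x‖) ^ N := by gcongr
        _ ≤ 2 ^ (N - 1) * (‖f x‖ ^ N + ‖f x - fn n x‖ ^ N) :=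
          add_pow_le (norm_nonneg _) (norm_nonneg _) N
        _ ≤ _ := by gcongr

theorem IsTestFunction.continuous_gradient {Ω : Set (EuclideanSpace ℝ (Fin N))}
    {φ : EuclideanSpace ℝ (Fin N) → ℝ} (hφ : IsTestFunction Ω φ) :
    Continuous (gradient φ) := by
  have : Continuous (fderiv ℝ φ) := hφ.1.continuous_fderiv (by simp)
  exact (InnerProductSpace.toDual ℝ _).symm.continuous.comp this

theorem IsSobolevZero.exists_approx (hN : N ≠ 0) {Ω : Set (EuclideanSpace ℝ (Fin N))}
    {u : EuclideanSpace ℝ (Fin N) → ℝ} {g : EuclideanSpace ℝ (Fin N) → EuclideanSpace ℝ (Fin N)}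
    (h : IsSobolevZero (N : ℝ≥0∞) Ω u g) :
    ∃ (φ : ℕ → EuclideanSpace ℝ (Fin N) → ℝ) (K : EuclideanSpace ℝ (Fin N) → ℝ),
      (∀ n, IsTestFunction Ω (φ n)) ∧ IntegrableOn K Ω ∧ ∀ᵐ x ∂volume.restrict Ω,
        Tendsto (fun n => φ n x) atTop (𝓝 (u x)) ∧
        Tendsto (fun n => gradient (φ n) x) atTop (𝓝 (g x)) ∧
        ∀ n, |φ n x| ^ N ≤ K x ∧ ‖gradient (φ n) x‖ ^ N ≤ K x := by
  obtain ⟨⟨hu, hg, -⟩, happ⟩ := h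
  choose φ hφ hlt using fun n : ℕ => happ ((2⁻¹ : ℝ≥0∞) ^ n) (ENNReal.pow_pos (by simp) n)
  obtain ⟨K₁, hK₁, h₁⟩ := exists_dominating_of_eLpNorm_lt hN hu
    (fun n => (hφ n).1.continuous.aestronglyMeasurable)
    (fun n => lt_of_le_of_lt le_self_add (hlt n))
  obtain ⟨K₂, hK₂, h₂⟩ := exists_dominating_of_eLpNorm_lt hN hg
    (fun n => (hφ n).continuous_gradient.aestronglyMeasurable)
    (fun n => lt_of_le_of_lt le_add_self (hlt n))
  refine ⟨φ, fun x => K₁ x + K₂ x, hφ, hK₁.add hK₂, ?_⟩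
  filter_upwards [h₁, h₂] with x hx₁ hx₂
  refine ⟨hx₁.1, hx₂.1, fun n => ?_⟩
  have a1 := hx₁.2 n
  have a2 := hx₂.2 n
  rw [Real.norm_eq_abs] at a1
  have : 0 ≤ |φ n x| ^ N := by positivity
  have : 0 ≤ ‖gradient (φ n) x‖ ^ N := by positivity
  constructor <;> linarith

theorem gradient_eq_zero_of_notMem {Ω : Set (EuclideanSpace ℝ (Fin N))}
    {φ : EuclideanSpace ℝ (Fin N) → ℝ} (hφ : IsTestFunction Ω φ)
    {x : EuclideanSpace ℝ (Fin N)} (hx : x ∉ Ω) : φ x = 0 ∧ fderiv ℝ φ x = 0 := by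
  have hx' : x ∉ tsupport φ := fun h => hx (hφ.2.2 h)
  exact ⟨image_eq_zero_of_notMem_tsupport hx', fderiv_of_notMem_tsupport ℝ hx'⟩

/-- The critical Hardy inequality in `W_0^{1,N}`. -/
theorem IsSobolevZero.hardy (hN : 2 ≤ N) {R : ℝ} (hR : 0 < R)
    {Ω : Set (EuclideanSpace ℝ (Fin N))} (hΩ : IsOpen Ω) (hsub : Ω ⊆ ball 0 R)
    {u : EuclideanSpace ℝ (Fin N) → ℝ} {g : EuclideanSpace ℝ (Fin N) → EuclideanSpace ℝ (Fin N)}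
    (h : IsSobolevZero (N : ℝ≥0∞) Ω u g) :
    ENNReal.ofReal ((((N : ℝ) - 1) / N) ^ N) *
        ∫⁻ x in Ω, ENNReal.ofReal (weight R x * |u x| ^ N) ≤
      ∫⁻ x in Ω, ENNReal.ofReal (‖g x‖ ^ N) := by
  have hN0 : N ≠ 0 := by omega
  have hN1 : (0 : ℝ) < N - 1 := by
    have : (2 : ℝ) ≤ N := by exact_mod_cast hN
    linarith
  obtain ⟨φ, K, hφ, hK, hae⟩ := h.exists_approx hN0
  set c := ENNReal.ofReal ((((N : ℝ) - 1) / N) ^ N) with hc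
  have hwm : Measurable (weight R : EuclideanSpace ℝ (Fin N) → ℝ) := by
    unfold weight; fun_prop
  -- The gradient side converges by domination, while the weighted side has no majorant yet and is
  -- only lower semicontinuous (Fatou, below); this is the direction the inequality needs.
  have hlim : Tendsto (fun n => ∫⁻ x in Ω, ENNReal.ofReal (‖gradient (φ n) x‖ ^ N)) atTop
      (𝓝 (∫⁻ x in Ω, ENNReal.ofReal (‖g x‖ ^ N))) := by
    refine tendsto_lintegral_of_dominated_convergence' (fun x => ENNReal.ofReal (K x))
      (fun n => ((hφ n).continuous_gradient.norm.pow N).measurable.ennreal_ofReal.aemeasurable)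
      (fun n => ?_) ?_ ?_
    · filter_upwards [hae] with x hx using ENNReal.ofReal_le_ofReal (hx.2.2 n).2
    · exact (lintegral_ofReal_le_lintegral_enorm K).trans_lt hK.2 |>.ne
    · filter_upwards [hae] with x hx
      exact ENNReal.tendsto_ofReal (hx.2.1.norm.pow N)
  have hn : ∀ n, c * ∫⁻ x in Ω, ENNReal.ofReal (weight R x * |φ n x| ^ N) ≤
      ∫⁻ x in Ω, ENNReal.ofReal (‖gradient (φ n) x‖ ^ N) := fun n => by
    have hfull : ∫⁻ x in Ω, ENNReal.ofReal (‖gradient (φ n) x‖ ^ N) =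
        ∫⁻ x, ENNReal.ofReal (‖gradient (φ n) x‖ ^ N) := by
      rw [← lintegral_indicator hΩ.measurableSet]
      refine lintegral_congr fun x => ?_
      by_cases hx : x ∈ Ω
      · simp [hx]
      · simp [hx, norm_gradient_eq, (gradient_eq_zero_of_notMem (hφ n) hx).2, hN0]
    rw [hfull]
    refine le_trans ?_ (hardy_test hN hR ((hφ n).mono hsub))
    gcongr
    exact Measure.restrict_le_self
  have hfatou : ∫⁻ x in Ω, c * ENNReal.ofReal (weight R x * |u x| ^ N) ≤
      liminf (fun n => ∫⁻ x in Ω, c * ENNReal.ofReal (weight R x * |φ n x| ^ N)) atTop := by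
    refine le_trans (le_of_eq ?_) (lintegral_liminf_le fun n => ?_)
    · refine lintegral_congr_ae ?_
      filter_upwards [hae] with x hx
      refine (Tendsto.liminf_eq ?_).symm
      exact ENNReal.Tendsto.const_mul
        (ENNReal.tendsto_ofReal ((hx.1.abs.pow N).const_mul _)) (.inr ENNReal.ofReal_ne_top)
    · have := (hφ n).1.continuous.measurable
      fun_prop
  rw [lintegral_const_mul' _ _ ENNReal.ofReal_ne_top] at hfatou
  rw [← hlim.liminf_eq]
  exact hfatou.trans (liminf_le_liminf (Eventually.of_forall fun n =>
    (lintegral_const_mul' _ _ ENNReal.ofReal_ne_top).le.trans (hn n)))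

/-! ### The radial identity in `W_0^{1,N}` -/

/-- Wherever `B` can be nonzero, `τ ≤ T`, that is `|x| ≥ R exp (-T)`. -/
theorem abs_radialWeight_le (hN : 2 ≤ N) {R : ℝ} (hR : 0 < R) {B : ℝ → ℝ} {T C : ℝ} (hC : 0 ≤ C)
    (hT : ∀ τ, T < τ → B τ = 0) (hBC : ∀ τ, 0 < τ → |B τ| ≤ C)
    {x : EuclideanSpace ℝ (Fin N)} (hx : x ∈ ball 0 R) :
    |radialWeight N R B x| ≤ ((R * Real.exp (-T)) ^ N)⁻¹ * C := by
  rcases eq_or_ne x 0 with rfl | hx0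
  · rw [radialWeight_zero hN, abs_zero]; positivity
  have hn := norm_pos_iff.2 hx0
  rw [mem_ball_zero_iff] at hx
  have hτ := log_div_norm_pos hx0 hx
  rcases lt_or_ge T (Real.log (R / ‖x‖)) with h | h
  · rw [radialWeight, hT _ h, mul_zero, abs_zero]; positivity
  · rw [radialWeight, abs_mul, abs_of_nonneg (by positivity)]
    have h1 : R * Real.exp (-T) ≤ ‖x‖ := by
      rw [Real.log_le_iff_le_exp (by positivity), div_le_iff₀ hn] at h
      calc R * Real.exp (-T) ≤ Real.exp T * ‖x‖ * Real.exp (-T) := by gcongr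
        _ = ‖x‖ * (Real.exp T * Real.exp (-T)) := by ring
        _ = ‖x‖ := by rw [← Real.exp_add]; simp
    gcongr
    exact hBC _ hτ

/-- With `B` and `B'` bounded, the coefficients are bounded on `Ω`, so both terms pass to the limit
along the approximating test functions by dominated convergence. -/
theorem IsSobolevZero.integral_radialWeight (hN : 2 ≤ N) {R : ℝ} (hR : 0 < R)
    {Ω : Set (EuclideanSpace ℝ (Fin N))} (hΩ : IsOpen Ω) (hsub : Ω ⊆ ball 0 R)
    {u : EuclideanSpace ℝ (Fin N) → ℝ} {g : EuclideanSpace ℝ (Fin N) → EuclideanSpace ℝ (Fin N)}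
    (h : IsSobolevZero (N : ℝ≥0∞) Ω u g) {B : ℝ → ℝ} (hB : ContDiffOn ℝ 1 B (Ioi 0))
    {T C : ℝ} (hT : ∀ τ, T < τ → B τ = 0) (hBC : ∀ τ, 0 < τ → |B τ| ≤ C)
    (hBC' : ∀ τ, 0 < τ → |deriv B τ| ≤ C) :
    ∫ x in Ω, (N * (|u x| ^ (N - 2) * u x * inner ℝ (g x) x) * radialWeight N R B x
      - |u x| ^ N * radialWeight N R (deriv B) x) = 0 := by
  have hN0 : N ≠ 0 := by omega
  obtain ⟨φ, K, hφ, hK, hae⟩ := h.exists_approx hN0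
  have hC : 0 ≤ C := (abs_nonneg _).trans (hBC 1 one_pos)
  set D := ((R * Real.exp (-T)) ^ N)⁻¹ * C with hD
  have hD0 : 0 ≤ D := by positivity
  have hn : ∀ n, ∫ x in Ω, (N * (|φ n x| ^ (N - 2) * φ n x * inner ℝ (gradient (φ n) x) x) *
      radialWeight N R B x - |φ n x| ^ N * radialWeight N R (deriv B) x) = 0 := fun n => by
    rw [setIntegral_eq_integral_of_forall_compl_eq_zero fun x hx => ?_]
    · simp_rw [inner_gradient_left]
      exact integral_test_radialWeight hN hR ((hφ n).mono hsub) hB hT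
    · simp [(gradient_eq_zero_of_notMem (hφ n) hx).1, hN0]
  have hlim := tendsto_integral_of_dominated_convergence (μ := volume.restrict Ω)
    (F := fun n x => N * (|φ n x| ^ (N - 2) * φ n x * inner ℝ (gradient (φ n) x) x) *
      radialWeight N R B x - |φ n x| ^ N * radialWeight N R (deriv B) x)
    (f := fun x => N * (|u x| ^ (N - 2) * u x * inner ℝ (g x) x) * radialWeight N R B x
      - |u x| ^ N * radialWeight N R (deriv B) x)
    (fun x => (N * 2 * R * D + D) * K x) (fun n => ?_) (hK.const_mul _) (fun n => ?_) ?_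
  · simp_rw [hn] at hlim
    exact tendsto_nhds_unique hlim tendsto_const_nhds
  · have := integrable_test_radialWeight hN hR ((hφ n).mono hsub) hB hT
    simp_rw [inner_gradient_left]
    exact (this.1.sub this.2).aestronglyMeasurable.restrict
  · filter_upwards [hae, ae_restrict_mem hΩ.measurableSet] with x hx hxΩ
    have hb1 := abs_radialWeight_le hN hR hC hT hBC (hsub hxΩ)
    have hb2 := abs_radialWeight_le hN hR hC (deriv_eq_zero_of_eventually_zero hT) hBC' (hsub hxΩ)
    obtain ⟨k1, k2⟩ := hx.2.2 n
    have hxR : ‖x‖ ≤ R := by simpa using (mem_ball_zero_iff.1 (hsub hxΩ)).le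
    set a := |φ n x| with ha
    set b := ‖gradient (φ n) x‖ with hb
    have hprod : a ^ (N - 1) * b ≤ 2 * K x := by
      have hy := nat_young hN (abs_nonneg (φ n x)) (norm_nonneg (gradient (φ n) x))
      have hN2 : (1 : ℝ) ≤ N := by exact_mod_cast (by omega : 1 ≤ N)
      rw [← ha, ← hb] at hy
      have h0 : 0 ≤ a ^ N := by positivity
      have : N * (a ^ (N - 1) * b) ≤ N * (2 * K x) := by nlinarith
      exact le_of_mul_le_mul_left this (by linarith)
    have hKx : 0 ≤ K x := le_trans (by positivity) k1
    have hinner : |inner ℝ (gradient (φ n) x) x| ≤ b * R :=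
      (abs_real_inner_le_norm _ _).trans (by gcongr)
    have e1 : |(N : ℝ) * (|φ n x| ^ (N - 2) * φ n x * inner ℝ (gradient (φ n) x) x) *
        radialWeight N R B x| ≤ N * 2 * R * D * K x := by
      rw [abs_mul, abs_mul, abs_mul, abs_mul, Nat.abs_cast, abs_pow, abs_abs, ← ha]
      calc N * (a ^ (N - 2) * a * |inner ℝ (gradient (φ n) x) x|) * |radialWeight N R B x|
          ≤ N * (a ^ (N - 2) * a * (b * R)) * D := by gcongr
        _ = N * (a ^ (N - 1) * b) * R * D := by
          rw [show N - 1 = N - 2 + 1 by omega, pow_succ]; ring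
        _ ≤ N * (2 * K x) * R * D := by gcongr
        _ = _ := by ring
    have e2 : |a ^ N * radialWeight N R (deriv B) x| ≤ K x * D := by
      rw [abs_mul, abs_of_nonneg (by positivity)]
      gcongr
    rw [Real.norm_eq_abs]
    refine (abs_sub _ _).trans ?_
    linarith
  · filter_upwards [hae] with x hx
    have hi : Tendsto (fun n => inner ℝ (gradient (φ n) x) x) atTop (𝓝 (inner ℝ (g x) x)) :=
      hx.2.1.inner tendsto_const_nhds
    exact (((((hx.1.abs.pow _).mul hx.1).mul hi).const_mul _).mul_const _).sub
      ((hx.1.abs.pow _).mul_const _)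

theorem deriv_smoothTransition_eq_zero {t : ℝ} (ht : t < 0 ∨ 1 < t) :
    deriv Real.smoothTransition t = 0 := by
  rcases ht with ht | ht
  · have : Real.smoothTransition =ᶠ[𝓝 t] fun _ => 0 := by
      filter_upwards [Iio_mem_nhds ht] with s hs
      exact Real.smoothTransition.zero_of_nonpos (le_of_lt hs)
    simp [this.deriv_eq]
  · have : Real.smoothTransition =ᶠ[𝓝 t] fun _ => 1 := by
      filter_upwards [Ioi_mem_nhds ht] with s hs
      exact Real.smoothTransition.one_of_one_le (le_of_lt hs)
    simp [this.deriv_eq]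

theorem exists_abs_deriv_smoothTransition_le :
    ∃ M : ℝ, 0 ≤ M ∧ ∀ t, |deriv Real.smoothTransition t| ≤ M := by
  have hc : Continuous (deriv Real.smoothTransition) :=
    (Real.smoothTransition.contDiff (n := 1)).continuous_deriv le_rfl
  obtain ⟨M, hM⟩ := (isCompact_Icc (a := (0 : ℝ)) (b := 1)).exists_bound_of_continuousOn
    hc.continuousOn
  have hM0 : 0 ≤ M := (norm_nonneg _).trans (hM 0 (by simp))
  refine ⟨M, hM0, fun t => ?_⟩
  by_cases ht : t ∈ Icc (0 : ℝ) 1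
  · exact hM t ht
  · rw [deriv_smoothTransition_eq_zero, abs_zero]
    · exact hM0
    · by_contra! h
      exact ht h

/-- A smooth cutoff to `[1 / T, 2 T]`, equal to one on `[2 / T, T]`. -/
noncomputable def logCutoff (T τ : ℝ) : ℝ :=
  Real.smoothTransition (2 - τ / T) * Real.smoothTransition (T * τ - 1)

theorem contDiff_logCutoff (T : ℝ) : ContDiff ℝ 1 (logCutoff T) :=
  (Real.smoothTransition.contDiff.comp (contDiff_const.sub (contDiff_id.div_const T))).mul
    (Real.smoothTransition.contDiff.comp ((contDiff_const.mul contDiff_id).sub contDiff_const))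

theorem logCutoff_nonneg (T τ : ℝ) : 0 ≤ logCutoff T τ :=
  mul_nonneg (Real.smoothTransition.nonneg _) (Real.smoothTransition.nonneg _)

theorem logCutoff_le_one (T τ : ℝ) : logCutoff T τ ≤ 1 :=
  mul_le_one₀ (Real.smoothTransition.le_one _) (Real.smoothTransition.nonneg _)
    (Real.smoothTransition.le_one _)

theorem logCutoff_eq_zero_of_gt {T τ : ℝ} (hT : 0 < T) (h : 2 * T < τ) : logCutoff T τ = 0 := by
  rw [logCutoff, Real.smoothTransition.zero_of_nonpos, zero_mul]
  rw [sub_nonpos, le_div_iff₀ hT]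
  exact h.le

theorem logCutoff_eq_zero_of_lt {T τ : ℝ} (hT : 0 < T) (h : τ < 1 / T) : logCutoff T τ = 0 := by
  rw [logCutoff, Real.smoothTransition.zero_of_nonpos (x := T * τ - 1), mul_zero]
  rw [lt_div_iff₀ hT] at h
  linarith

theorem deriv_logCutoff (T τ : ℝ) : deriv (logCutoff T) τ =
    -(deriv Real.smoothTransition (2 - τ / T) / T) * Real.smoothTransition (T * τ - 1) +
      Real.smoothTransition (2 - τ / T) * (deriv Real.smoothTransition (T * τ - 1) * T) := by
  have hS : ∀ t, HasDerivAt Real.smoothTransition (deriv Real.smoothTransition t) t := fun t =>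
    ((Real.smoothTransition.contDiff (n := 1)).differentiable one_ne_zero _).hasDerivAt
  have h1 : HasDerivAt (fun τ => 2 - τ / T) (-(1 / T)) τ :=
    ((hasDerivAt_id τ).div_const T).const_sub 2
  have h2 : HasDerivAt (fun τ => T * τ - 1) (T * 1) τ :=
    ((hasDerivAt_id τ).const_mul T).sub_const 1
  have h3 : HasDerivAt (logCutoff T) _ τ := ((hS _).comp τ h1).mul ((hS _).comp τ h2)
  rw [h3.deriv]
  simp only [Function.comp_apply]
  ring

/-- The bound is uniform in `T` by scale invariance: the two transitions occur where `τ / T` or `T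
τ` lies in `[1, 2]`, so `τ` compensates the size of the derivative. -/
theorem abs_mul_deriv_logCutoff_le {M : ℝ} (hM : ∀ t, |deriv Real.smoothTransition t| ≤ M)
    {T τ : ℝ} (hT : 0 < T) (hτ : 0 < τ) : |τ * deriv (logCutoff T) τ| ≤ 4 * M := by
  have hM0 : 0 ≤ M := (abs_nonneg _).trans (hM 0)
  have h1 : |τ / T * deriv Real.smoothTransition (2 - τ / T)| ≤ 2 * M := by
    rcases le_or_gt (τ / T) 2 with h | h
    · rw [abs_mul, abs_of_nonneg (by positivity)]
      exact mul_le_mul h (hM _) (abs_nonneg _) (by norm_num)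
    · rw [deriv_smoothTransition_eq_zero (.inl (by linarith)), mul_zero, abs_zero]; positivity
  have h2 : |T * τ * deriv Real.smoothTransition (T * τ - 1)| ≤ 2 * M := by
    rcases le_or_gt (T * τ) 2 with h | h
    · rw [abs_mul, abs_of_nonneg (by positivity)]
      exact mul_le_mul h (hM _) (abs_nonneg _) (by norm_num)
    · rw [deriv_smoothTransition_eq_zero (.inr (by linarith)), mul_zero, abs_zero]; positivity
  have e : τ * deriv (logCutoff T) τ =
      -(τ / T * deriv Real.smoothTransition (2 - τ / T) * Real.smoothTransition (T * τ - 1)) +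
      T * τ * deriv Real.smoothTransition (T * τ - 1) * Real.smoothTransition (2 - τ / T) := by
    rw [deriv_logCutoff]; ring
  have hle : ∀ a t : ℝ, |a * Real.smoothTransition t| ≤ |a| := fun a t => by
    rw [abs_mul, abs_of_nonneg (Real.smoothTransition.nonneg t)]
    exact mul_le_of_le_one_right (abs_nonneg _) (Real.smoothTransition.le_one t)
  rw [e]
  refine (abs_add_le _ _).trans ?_
  rw [abs_neg]
  linarith [hle (τ / T * deriv Real.smoothTransition (2 - τ / T)) (T * τ - 1),
    hle (T * τ * deriv Real.smoothTransition (T * τ - 1)) (2 - τ / T)]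

theorem eventually_logCutoff_eq_one {τ : ℝ} (hτ : 0 < τ) :
    ∀ᶠ T : ℝ in atTop, logCutoff T τ = 1 ∧ deriv (logCutoff T) τ = 0 := by
  filter_upwards [eventually_gt_atTop 0, eventually_gt_atTop τ, eventually_gt_atTop (2 / τ)]
    with T h0 h1 h2
  have h3 : τ / T < 1 := (div_lt_one h0).2 h1
  rw [div_lt_iff₀ hτ] at h2
  constructor
  · rw [logCutoff, Real.smoothTransition.one_of_one_le (by linarith),
      Real.smoothTransition.one_of_one_le (by linarith), one_mul]
  · rw [deriv_logCutoff, deriv_smoothTransition_eq_zero (.inr (by linarith)),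
      deriv_smoothTransition_eq_zero (.inr (by linarith))]
    ring

theorem exists_abs_le_of_continuousOn_Ioi {F : ℝ → ℝ} (hF : ContinuousOn F (Ioi 0)) {a b : ℝ}
    (ha : 0 < a) (h1 : ∀ τ, τ < a → F τ = 0) (h2 : ∀ τ, b < τ → F τ = 0) :
    ∃ C : ℝ, 0 ≤ C ∧ ∀ τ, |F τ| ≤ C := by
  obtain ⟨C, hC⟩ := (isCompact_Icc (a := a) (b := b)).exists_bound_of_continuousOn
    (hF.mono fun τ hτ => lt_of_lt_of_le ha hτ.1)
  refine ⟨max C 0, le_max_right _ _, fun τ => ?_⟩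
  by_cases hτ : τ ∈ Icc a b
  · exact (hC τ hτ).trans (le_max_left _ _)
  · have : F τ = 0 := by
      rcases lt_or_ge τ a with h | h
      · exact h1 τ h
      · exact h2 τ (by by_contra! h'; exact hτ ⟨h, h'⟩)
    rw [this, abs_zero]; exact le_max_right _ _

theorem measurable_radialWeight (R : ℝ) {B : ℝ → ℝ} (hB : Measurable B) :
    Measurable (radialWeight N R B) := by
  unfold radialWeight; fun_prop

/-- This is the identity for the unbounded profile `τ^{1-N} f(τ)`. Once the weighted integral is
finite, cutoffs near the sphere (`τ → 0`) and near the origin (`τ → ∞`) can both be removed by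
dominated convergence. -/
theorem IsSobolevZero.integral_weight_identity (hN : 2 ≤ N) {R : ℝ} (hR : 0 < R)
    {Ω : Set (EuclideanSpace ℝ (Fin N))} (hΩ : IsOpen Ω) (hsub : Ω ⊆ ball 0 R)
    {u : EuclideanSpace ℝ (Fin N) → ℝ} {g : EuclideanSpace ℝ (Fin N) → EuclideanSpace ℝ (Fin N)}
    (h : IsSobolevZero (N : ℝ≥0∞) Ω u g) (hA : IntegrableOn (fun x => weight R x * |u x| ^ N) Ω)
    {f : ℝ → ℝ} (hf : ContDiff ℝ 1 f) {C : ℝ} (hfC : ∀ τ, 0 < τ → |f τ| ≤ C)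
    (hfC' : ∀ τ, 0 < τ → |τ * deriv f τ| ≤ C) :
    ∫ x in Ω, (N * (|u x| ^ (N - 2) * u x * inner ℝ (g x) x) *
        radialWeight N R (fun τ => (τ ^ (N - 1))⁻¹ * f τ) x
      + |u x| ^ N * radialWeight N R (fun τ => (τ ^ N)⁻¹ * ((N - 1) * f τ - τ * deriv f τ)) x)
      = 0 := by
  have hN0 : N ≠ 0 := by omega
  have hN1 : (1 : ℝ) ≤ N := by exact_mod_cast (by omega : 1 ≤ N)
  have hC0 : 0 ≤ C := (abs_nonneg _).trans (hfC 1 one_pos)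
  obtain ⟨M, hM0, hM⟩ := exists_abs_deriv_smoothTransition_le
  set B : ℝ → ℝ → ℝ := fun T τ => (τ ^ (N - 1))⁻¹ * (logCutoff T τ * f τ) with hB
  have hBc : ∀ T, ContDiffOn ℝ 1 (B T) (Ioi 0) := fun T =>
    (contDiffOn_inv_pow _).mul ((contDiff_logCutoff T).mul hf).contDiffOn
  have hB1 : ∀ T, 0 < T → ∀ τ, 2 * T < τ → B T τ = 0 := fun T hT τ hτ => by
    simp [hB, logCutoff_eq_zero_of_gt hT hτ]
  have hB2 : ∀ T, 0 < T → ∀ τ, τ < 1 / T → B T τ = 0 := fun T hT τ hτ => by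
    simp [hB, logCutoff_eq_zero_of_lt hT hτ]
  have hB3 : ∀ T, 0 < T → ∀ τ, τ < 1 / T → deriv (B T) τ = 0 := fun T hT τ hτ => by
    have : B T =ᶠ[𝓝 τ] fun _ => 0 := by
      filter_upwards [Iio_mem_nhds hτ] with t ht using hB2 T hT t ht
    simp [this.deriv_eq]
  have hBd : ∀ T τ, 0 < τ → deriv (B T) τ =
      -((τ ^ N)⁻¹ * (((N - 1) * f τ - τ * deriv f τ) * logCutoff T τ
        - τ * deriv (logCutoff T) τ * f τ)) := fun T τ hτ => by
    have h1 := hasDerivAt_inv_pow_pred hN hτ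
    have h2 := ((contDiff_logCutoff T).differentiable one_ne_zero τ).hasDerivAt
    have h3 := (hf.differentiable one_ne_zero τ).hasDerivAt
    have h4 : HasDerivAt (B T) _ τ := h1.mul (h2.mul h3)
    rw [h4.deriv]
    have e : (τ ^ (N - 1))⁻¹ = (τ ^ N)⁻¹ * τ := by
      obtain ⟨m, rfl⟩ : ∃ m, N = m + 1 := ⟨N - 1, by omega⟩
      rw [pow_succ, Nat.add_sub_cancel]; field_simp
    rw [e]
    ring
  have hn : ∀ T, 0 < T → ∫ x in Ω, (N * (|u x| ^ (N - 2) * u x * inner ℝ (g x) x) *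
      radialWeight N R (B T) x - |u x| ^ N * radialWeight N R (deriv (B T)) x) = 0 :=
    fun T hT => by
    obtain ⟨C₁, h₁, hC₁⟩ := exists_abs_le_of_continuousOn_Ioi (hBc T).continuousOn
      (one_div_pos.2 hT) (hB2 T hT) (hB1 T hT)
    obtain ⟨C₂, h₂, hC₂⟩ := exists_abs_le_of_continuousOn_Ioi
      ((hBc T).continuousOn_deriv_of_isOpen isOpen_Ioi le_rfl)
      (one_div_pos.2 hT) (hB3 T hT) (deriv_eq_zero_of_eventually_zero (hB1 T hT))
    exact h.integral_radialWeight hN hR hΩ hsub (hBc T) (hB1 T hT) (C := C₁ + C₂)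
      (fun τ _ => by linarith [hC₁ τ]) (fun τ _ => by linarith [hC₂ τ])
  have hum := h.1.1.1
  have hgm := h.1.2.1.1
  have hG : IntegrableOn (fun x => ‖g x‖ ^ N) Ω := by
    exact h.1.2.1.integrable_norm_pow (p := N) hN0
  have hlim := tendsto_integral_filter_of_dominated_convergence (μ := volume.restrict Ω)
    (l := (atTop : Filter ℝ))
    (F := fun T x => N * (|u x| ^ (N - 2) * u x * inner ℝ (g x) x) *
      radialWeight N R (B T) x - |u x| ^ N * radialWeight N R (deriv (B T)) x)
    (f := fun x => N * (|u x| ^ (N - 2) * u x * inner ℝ (g x) x) *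
        radialWeight N R (fun τ => (τ ^ (N - 1))⁻¹ * f τ) x
      + |u x| ^ N * radialWeight N R (fun τ => (τ ^ N)⁻¹ * ((N - 1) * f τ - τ * deriv f τ)) x)
    -- The first summand bounds the cross term through Young's inequality; the second bounds the
    -- `B'` term, with `4 * M * C` paying for the derivative of the cutoff.
    (fun x => C * ((N - 1) * (weight R x * |u x| ^ N) + ‖g x‖ ^ N)
      + (N * C + 4 * M * C) * (weight R x * |u x| ^ N)) ?_ ?_ ?_ ?_
  · refine tendsto_nhds_unique hlim (tendsto_const_nhds.congr' ?_)
    filter_upwards [eventually_gt_atTop 0] with T hT using (hn T hT).symm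
  · refine Eventually.of_forall fun T => ?_
    have hBm : Measurable (B T) := by
      have := (contDiff_logCutoff T).continuous.measurable
      have := hf.continuous.measurable
      simp only [hB]
      fun_prop
    have m1 : AEStronglyMeasurable (radialWeight N R (B T)) (volume.restrict Ω) :=
      (measurable_radialWeight R hBm).aestronglyMeasurable
    have m2 : AEStronglyMeasurable (radialWeight N R (deriv (B T))) (volume.restrict Ω) :=
      (measurable_radialWeight R (measurable_deriv _)).aestronglyMeasurable
    have m3 : AEStronglyMeasurable (fun x => inner ℝ (g x) x) (volume.restrict Ω) :=
      hgm.inner aestronglyMeasurable_id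
    have m4 : AEStronglyMeasurable (fun x => |u x|) (volume.restrict Ω) := hum.norm
    exact ((((((m4.pow _).mul hum).mul m3).const_mul _).mul m1).sub ((m4.pow _).mul m2))
  · filter_upwards [eventually_gt_atTop 0] with T hT
    filter_upwards [ae_restrict_mem hΩ.measurableSet] with x hxΩ
    rcases eq_or_ne x 0 with rfl | hx0
    · simp only [radialWeight_zero hN, weight_eq_radialWeight]
      simp
      positivity
    have hxR : ‖x‖ < R := by simpa using hsub hxΩ
    have hτ := log_div_norm_pos hx0 hxR
    have hnx := norm_pos_iff.2 hx0
    set τ := Real.log (R / ‖x‖) with hτdef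
    have hw : weight R x * |u x| ^ N = (|u x| / (‖x‖ * τ)) ^ N := by
      rw [weight_eq_radialWeight, mul_comm, ← abs_pow_mul_inv_pow]; rfl
    have hA0 : 0 ≤ |u x| / (‖x‖ * τ) := by positivity
    have hχ0 := logCutoff_nonneg T τ
    have hχ1 := logCutoff_le_one T τ
    have e1 : |N * (|u x| ^ (N - 2) * u x * inner ℝ (g x) x) * radialWeight N R (B T) x| ≤
        C * ((N - 1) * (weight R x * |u x| ^ N) + ‖g x‖ ^ N) := by
      have h1 := abs_cross_term_le hN (v := u x) hnx hτ (abs_real_inner_le_norm (g x) x)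
      have h2 := nat_young hN hA0 (norm_nonneg (g x))
      have h3 : |logCutoff T τ * f τ| ≤ C := by
        rw [abs_mul, abs_of_nonneg hχ0]
        exact (mul_le_of_le_one_left (abs_nonneg _) hχ1).trans (hfC τ hτ)
      have e : N * (|u x| ^ (N - 2) * u x * inner ℝ (g x) x) * radialWeight N R (B T) x =
          N * ((|u x| ^ (N - 2) * u x * inner ℝ (g x) x) * ((‖x‖ ^ N)⁻¹ * (τ ^ (N - 1))⁻¹)) *
            (logCutoff T τ * f τ) := by
        simp only [radialWeight, hB, ← hτdef]; ring
      rw [e, abs_mul, abs_mul, Nat.abs_cast, hw]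
      calc _ ≤ N * ((|u x| / (‖x‖ * τ)) ^ (N - 1) * ‖g x‖) * C := by gcongr
        _ ≤ ((N - 1) * (|u x| / (‖x‖ * τ)) ^ N + ‖g x‖ ^ N) * C := by gcongr
        _ = _ := mul_comm _ _
    have e2 : |(|u x|) ^ N * radialWeight N R (deriv (B T)) x| ≤
        (N * C + 4 * M * C) * (weight R x * |u x| ^ N) := by
      have e : |u x| ^ N * radialWeight N R (deriv (B T)) x = -((weight R x * |u x| ^ N) *
          (((N - 1) * f τ - τ * deriv f τ) * logCutoff T τ
        - τ * deriv (logCutoff T) τ * f τ)) := by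
        rw [weight_eq_radialWeight]
        simp only [radialWeight, ← hτdef]
        rw [hBd T τ hτ]
        ring
      rw [e, abs_neg, abs_mul, mul_comm, hw, abs_of_nonneg (pow_nonneg hA0 N)]
      refine mul_le_mul_of_nonneg_right ?_ (pow_nonneg hA0 N)
      have a1 : |(N - 1) * f τ - τ * deriv f τ| ≤ N * C := by
        refine (abs_sub _ _).trans ?_
        rw [abs_mul, abs_of_nonneg (by linarith : (0 : ℝ) ≤ N - 1)]
        have := mul_le_mul_of_nonneg_left (hfC τ hτ) (by linarith : (0 : ℝ) ≤ N - 1)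
        linarith [hfC' τ hτ]
      refine (abs_sub _ _).trans (add_le_add ?_ ?_)
      · rw [abs_mul, abs_of_nonneg hχ0]
        exact (mul_le_of_le_one_right (abs_nonneg _) hχ1).trans a1
      · rw [abs_mul]
        exact mul_le_mul (abs_mul_deriv_logCutoff_le hM hT hτ) (hfC τ hτ) (abs_nonneg _)
          (by positivity)
    rw [Real.norm_eq_abs]
    exact (abs_sub _ _).trans (add_le_add e1 e2)
  · exact (((hA.const_mul _).add hG).const_mul _).add (hA.const_mul _)
  · filter_upwards [ae_restrict_mem hΩ.measurableSet] with x hxΩ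
    refine tendsto_const_nhds.congr' ?_
    rcases eq_or_ne x 0 with rfl | hx0
    · simp [radialWeight_zero hN]
    have hxR : ‖x‖ < R := by simpa using hsub hxΩ
    have hτ := log_div_norm_pos hx0 hxR
    filter_upwards [eventually_logCutoff_eq_one hτ] with T hT
    simp only [radialWeight]
    rw [hBd _ _ hτ]
    simp only [hB, hT.1, hT.2]
    ring

/-! ### The equality case -/

theorem ae_ne_zero_of_two_le (hN : 2 ≤ N) (Ω : Set (EuclideanSpace ℝ (Fin N))) :
    ∀ᵐ x ∂volume.restrict Ω, x ≠ 0 := by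
  have : Nonempty (Fin N) := ⟨⟨0, by omega⟩⟩
  exact ae_restrict_of_ae (Measure.ae_ne volume 0)

theorem weight_mul_eq_pow (R : ℝ) (x : EuclideanSpace ℝ (Fin N)) (v : ℝ) :
    weight R x * |v| ^ N = (|v| / (‖x‖ * Real.log (R / ‖x‖))) ^ N := by
  rw [weight_eq_radialWeight, mul_comm, ← abs_pow_mul_inv_pow]; rfl

theorem weight_mul_nonneg {R : ℝ} {x : EuclideanSpace ℝ (Fin N)} (hx : x ∈ ball 0 R) (v : ℝ) :
    0 ≤ weight R x * |v| ^ N := by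
  rw [weight_mul_eq_pow]
  rcases eq_or_ne x 0 with rfl | hx0
  · simp
  · have := log_div_norm_pos hx0 (mem_ball_zero_iff.1 hx)
    positivity

/-- Equality in the critical Hardy inequality forces `u = 0`. -/
theorem IsSobolevZero.eq_zero_of_hardy_eq (hN : 2 ≤ N) {R : ℝ} (hR : 0 < R)
    {Ω : Set (EuclideanSpace ℝ (Fin N))} (hΩ : IsOpen Ω) (hsub : Ω ⊆ ball 0 R)
    {u : EuclideanSpace ℝ (Fin N) → ℝ} {g : EuclideanSpace ℝ (Fin N) → EuclideanSpace ℝ (Fin N)}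
    (h : IsSobolevZero (N : ℝ≥0∞) Ω u g)
    (heq : ENNReal.ofReal ((((N : ℝ) - 1) / N) ^ N) *
        ∫⁻ x in Ω, ENNReal.ofReal (weight R x * |u x| ^ N) =
      ∫⁻ x in Ω, ENNReal.ofReal (‖g x‖ ^ N)) :
    u =ᵐ[volume.restrict Ω] 0 := by
  have hN0 : N ≠ 0 := by omega
  have hNpos : (0 : ℝ) < N := by positivity
  have hN1 : (0 : ℝ) < N - 1 := by
    have : (2 : ℝ) ≤ N := by exact_mod_cast hN
    linarith
  set α : ℝ := ((N : ℝ) - 1) / N with hα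
  have hα0 : 0 < α := by positivity
  have hNα : N * α = N - 1 := by rw [hα]; field_simp
  have hαN : 0 < α ^ N := by positivity
  have hαpow : α ^ N = α ^ (N - 1) * α := by
    rw [← pow_succ]; congr 1; omega
  set w : EuclideanSpace ℝ (Fin N) → ℝ := fun x => weight R x * |u x| ^ N with hw
  have hmem := ae_restrict_mem (μ := volume) hΩ.measurableSet
  have hne := ae_ne_zero_of_two_le hN Ω
  have hum := h.1.1.1
  have hgm := h.1.2.1.1
  have hwm : Measurable (weight R : EuclideanSpace ℝ (Fin N) → ℝ) := by
    unfold weight; fun_prop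
  have hw0 : ∀ᵐ x ∂volume.restrict Ω, 0 ≤ w x := by
    filter_upwards [hmem] with x hx using weight_mul_nonneg (hsub hx) _
  have hG : Integrable (fun x => ‖g x‖ ^ N) (volume.restrict Ω) :=
    h.1.2.1.integrable_norm_pow (p := N) hN0
  -- Equality itself forces finiteness, since the gradient integral is finite.
  have hwint : Integrable w (volume.restrict Ω) := by
    refine ⟨hwm.aestronglyMeasurable.mul (hum.norm.pow N), ?_⟩
    rw [hasFiniteIntegral_iff_ofReal hw0, lt_top_iff_ne_top]
    intro htop
    rw [htop, ENNReal.mul_top (by simpa using hαN),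
      ← ofReal_integral_eq_lintegral_ofReal hG (Eventually.of_forall fun x => by positivity)] at heq
    exact ENNReal.ofReal_ne_top heq.symm
  have hreal : α ^ N * ∫ x in Ω, w x = ∫ x in Ω, ‖g x‖ ^ N := by
    rw [← ofReal_integral_eq_lintegral_ofReal hG (Eventually.of_forall fun x => by positivity),
      ← ofReal_integral_eq_lintegral_ofReal hwint hw0, ← ENNReal.ofReal_mul hαN.le] at heq
    refine (ENNReal.ofReal_eq_ofReal_iff ?_ ?_).1 heq
    · exact mul_nonneg hαN.le (integral_nonneg_of_ae hw0)
    · exact integral_nonneg fun x => by positivity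
  set Y : EuclideanSpace ℝ (Fin N) → ℝ := fun x =>
    -((|u x| ^ (N - 2) * u x * inner ℝ (g x) x) *
      radialWeight N R (fun τ => (τ ^ (N - 1))⁻¹) x) with hY
  have hYle : ∀ᵐ x ∂volume.restrict Ω,
      |Y x| ≤ (|u x| / (‖x‖ * Real.log (R / ‖x‖))) ^ (N - 1) * ‖g x‖ := by
    filter_upwards [hmem, hne] with x hx hx0
    have hτ := log_div_norm_pos hx0 (mem_ball_zero_iff.1 (hsub hx))
    rw [hY, abs_neg]
    exact abs_cross_term_le hN (norm_pos_iff.2 hx0) hτ (abs_real_inner_le_norm (g x) x)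
  have hτ0 : ∀ᵐ x ∂volume.restrict Ω, 0 < Real.log (R / ‖x‖) := by
    filter_upwards [hmem, hne] with x hx hx0
    exact log_div_norm_pos hx0 (mem_ball_zero_iff.1 (hsub hx))
  have hYint : Integrable Y (volume.restrict Ω) := by
    refine Integrable.mono' ((hwint.const_mul ((N : ℝ) - 1)).add hG) ?_ ?_
    · have m1 : AEStronglyMeasurable (radialWeight N R (fun τ => (τ ^ (N - 1))⁻¹))
          (volume.restrict Ω) :=
        (measurable_radialWeight R (by fun_prop)).aestronglyMeasurable
      have m3 : AEStronglyMeasurable (fun x => inner ℝ (g x) x) (volume.restrict Ω) :=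
        hgm.inner aestronglyMeasurable_id
      have m4 : AEStronglyMeasurable (fun x => |u x|) (volume.restrict Ω) := hum.norm
      exact ((((m4.pow _).mul hum).mul m3).mul m1).neg
    · filter_upwards [hYle, hτ0] with x hx hτ
      have hy := nat_young hN (a := |u x| / (‖x‖ * Real.log (R / ‖x‖))) (by positivity)
        (norm_nonneg (g x))
      rw [Real.norm_eq_abs, Pi.add_apply, hw]
      simp only [weight_mul_eq_pow]
      refine hx.trans (le_trans ?_ hy)
      have : (1 : ℝ) ≤ N := by linarith
      refine le_mul_of_one_le_left (by positivity) this
  have hI1 := h.integral_weight_identity hN hR hΩ hsub hwint (f := fun _ => 1) contDiff_const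
    (C := 1) (fun τ _ => by simp) (fun τ _ => by simp)
  have hI1' : ∫ x in Ω, (-(N * Y x) + (N - 1) * w x) = 0 := by
    rw [← hI1]
    congr 1 with x
    simp only [hY, hw, weight_eq_radialWeight, radialWeight, deriv_const']
    ring
  have hYN : Integrable (fun x => -(N * Y x) + (N - 1) * w x) (volume.restrict Ω) :=
    (hYint.const_mul _).neg.add (hwint.const_mul _)
  -- `D` is the defect in Young's inequality for `α A` and `‖g x‖`, with the product replaced by the
  -- signed cross term `Y`. It is nonnegative, and the identity with `f = 1` together with the
  -- assumed equality makes its integral vanish.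
  set D : EuclideanSpace ℝ (Fin N) → ℝ := fun x =>
    (‖g x‖ ^ N - α ^ N * w x) + α ^ (N - 1) * (-(N * Y x) + (N - 1) * w x) with hD
  have hGw : Integrable (fun x => ‖g x‖ ^ N - α ^ N * w x) (volume.restrict Ω) :=
    hG.sub (hwint.const_mul _)
  have hDint : Integrable D (volume.restrict Ω) :=
    hGw.add (hYN.const_mul _)
  have hD0 : ∫ x in Ω, D x = 0 := by
    simp only [hD]
    rw [integral_add hGw (hYN.const_mul _), integral_sub hG (hwint.const_mul _), integral_const_mul, integral_const_mul, hI1', hreal]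
    ring
  have hYeq : ∀ᵐ x ∂volume.restrict Ω, 0 ≤ D x ∧ (D x = 0 → Y x = α * w x) := by
    filter_upwards [hYle, hτ0] with x hx hτ
    set A := |u x| / (‖x‖ * Real.log (R / ‖x‖)) with hA
    have hA0 : 0 ≤ A := by positivity
    have hwA : w x = A ^ N := weight_mul_eq_pow R x (u x)
    have hDx : D x = ((N - 1) * (α * A) ^ N + ‖g x‖ ^ N) - N * (α ^ (N - 1) * Y x) := by
      simp only [hD, hwA, mul_pow, hαpow]
      linear_combination -(α ^ (N - 1) * A ^ N) * hNα
    have hy := nat_young hN (mul_nonneg hα0.le hA0) (norm_nonneg (g x))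
    have hle : N * (α ^ (N - 1) * Y x) ≤ N * ((α * A) ^ (N - 1) * ‖g x‖) := by
      rw [mul_pow, mul_assoc]
      have := (le_abs_self _).trans hx
      gcongr
    refine ⟨by linarith, fun h0 => ?_⟩
    have hge := eq_of_nat_young_eq hN (mul_nonneg hα0.le hA0) (norm_nonneg (g x)) (by linarith)
    have h3 : N * (α ^ (N - 1) * Y x) = N * ((α * A) ^ (N - 1) * ‖g x‖) := by linarith
    have h4 := mul_left_cancel₀ hNpos.ne' h3
    rw [mul_pow, mul_assoc] at h4
    have h5 := mul_left_cancel₀ (pow_pos hα0 _).ne' h4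
    rw [h5, hge, hwA, mul_left_comm, ← pow_succ]
    congr 2
    omega
  have hDae := (integral_eq_zero_iff_of_nonneg_ae (hYeq.mono fun x hx => hx.1) hDint).1 hD0
  -- What matters about `arctan` is that it is bounded, has `τ f'(τ)` bounded, and is strictly
  -- increasing. Since `Y = α w`, the terms with `f` itself cancel and only `w τ f'(τ)`, the
  -- function `p` below, is left.
  have hI2 := h.integral_weight_identity hN hR hΩ hsub hwint (f := Real.arctan)
    Real.contDiff_arctan (C := 2)
    (fun τ _ => by
      have := Real.arctan_lt_pi_div_two τ
      have := Real.neg_pi_div_two_lt_arctan τ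
      have := Real.pi_lt_four
      rw [abs_le]; constructor <;> linarith)
    (fun τ hτ => by
      rw [Real.deriv_arctan, abs_of_nonneg (by positivity), mul_one_div,
        div_le_iff₀ (by positivity)]
      nlinarith [sq_nonneg (τ - 1)])
  set p : EuclideanSpace ℝ (Fin N) → ℝ := fun x =>
    w x * (Real.log (R / ‖x‖) * (1 / (1 + Real.log (R / ‖x‖) ^ 2))) with hp
  have hp0 : ∀ᵐ x ∂volume.restrict Ω, 0 ≤ p x := by
    filter_upwards [hw0, hτ0] with x h1 h2
    rw [hp]; positivity
  have hpint : Integrable p (volume.restrict Ω) := by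
    refine Integrable.mono' hwint (hwint.1.mul ?_) ?_
    · exact Measurable.aestronglyMeasurable (by fun_prop)
    · filter_upwards [hw0, hτ0, hp0] with x h1 h2 h3
      rw [Real.norm_eq_abs, abs_of_nonneg h3]
      refine mul_le_of_le_one_right h1 ?_
      rw [mul_one_div, div_le_one (by positivity)]
      nlinarith [sq_nonneg (Real.log (R / ‖x‖) - 1)]
  have hpz : ∫ x in Ω, p x = 0 := by
    rw [← neg_eq_zero, ← integral_neg, ← hI2]
    refine integral_congr_ae ?_
    filter_upwards [hYeq, hDae] with x h1 h2
    have h3 := h1.2 h2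
    have h4 : N * (|u x| ^ (N - 2) * u x * inner ℝ (g x) x) *
        radialWeight N R (fun τ => (τ ^ (N - 1))⁻¹ * Real.arctan τ) x =
        -(N * Y x) * Real.arctan (Real.log (R / ‖x‖)) := by
      simp only [hY, radialWeight]; ring
    have h5 : |u x| ^ N * radialWeight N R (fun τ => (τ ^ N)⁻¹ *
        ((N - 1) * Real.arctan τ - τ * deriv Real.arctan τ)) x =
        w x * ((N - 1) * Real.arctan (Real.log (R / ‖x‖)) -
          Real.log (R / ‖x‖) * (1 / (1 + Real.log (R / ‖x‖) ^ 2))) := by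
      simp only [hw, weight_eq_radialWeight, radialWeight, Real.deriv_arctan]; ring
    rw [h4, h5, h3, hp]
    linear_combination (w x * Real.arctan (Real.log (R / ‖x‖))) * hNα
  have hpae := (integral_eq_zero_iff_of_nonneg_ae hp0 hpint).1 hpz
  filter_upwards [hpae, hne, hτ0] with x h1 hx0 hτ
  have h2 : 0 < Real.log (R / ‖x‖) * (1 / (1 + Real.log (R / ‖x‖) ^ 2)) := by positivity
  have h3 : w x = 0 := (mul_eq_zero.1 h1).resolve_right h2.ne'
  rw [hw] at h3
  simp only [weight_mul_eq_pow] at h3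
  have h4 := pow_eq_zero_iff hN0 |>.1 h3
  rw [div_eq_zero_iff] at h4
  have hn := norm_pos_iff.2 hx0
  exact abs_eq_zero.1 (h4.resolve_right (mul_pos hn hτ).ne')

/-! ### Exponential coordinates at a boundary point -/

/-- Exponential coordinates on the half-space `{x | 0 < ⟪e, x₀ - x⟫}`. -/
noncomputable def expChart (x₀ e : EuclideanSpace ℝ (Fin N)) (l L k : ℝ)
    (z : EuclideanSpace ℝ (Fin N)) : EuclideanSpace ℝ (Fin N) :=
  x₀ - (L • z + (l * Real.exp (k * inner ℝ e z) - L * inner ℝ e z) • e)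

/-- The inverse of `expChart`. -/
noncomputable def logChart (x₀ e : EuclideanSpace ℝ (Fin N)) (l L k : ℝ)
    (x : EuclideanSpace ℝ (Fin N)) : EuclideanSpace ℝ (Fin N) :=
  L⁻¹ • ((x₀ - x) - inner ℝ e (x₀ - x) • e) + (Real.log (inner ℝ e (x₀ - x) / l) / k) • e

section Chart

variable {x₀ e : EuclideanSpace ℝ (Fin N)} {l L k : ℝ}

theorem inner_sub_expChart (he : ‖e‖ = 1) (z : EuclideanSpace ℝ (Fin N)) :
    inner ℝ e (x₀ - expChart x₀ e l L k z) = l * Real.exp (k * inner ℝ e z) := by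
  rw [expChart, sub_sub_cancel, inner_add_right, inner_smul_right, inner_smul_right,
    real_inner_self_eq_norm_sq, he]
  ring

theorem logChart_expChart (he : ‖e‖ = 1) (hl : 0 < l) (hL : 0 < L) (hk : 0 < k)
    (z : EuclideanSpace ℝ (Fin N)) : logChart x₀ e l L k (expChart x₀ e l L k z) = z := by
  rw [logChart, inner_sub_expChart he, mul_div_cancel_left₀ _ hl.ne', Real.log_exp,
    mul_div_cancel_left₀ _ hk.ne', expChart, sub_sub_cancel]
  have : L • z + (l * Real.exp (k * inner ℝ e z) - L * inner ℝ e z) • e -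
      (l * Real.exp (k * inner ℝ e z)) • e = L • (z - inner ℝ e z • e) := by
    module
  rw [this, inv_smul_smul₀ hL.ne']
  abel

theorem expChart_logChart (he : ‖e‖ = 1) (hl : 0 < l) (hL : 0 < L) (hk : 0 < k)
    {x : EuclideanSpace ℝ (Fin N)} (hx : 0 < inner ℝ e (x₀ - x)) :
    expChart x₀ e l L k (logChart x₀ e l L k x) = x := by
  set y := x₀ - x with hy
  have h1 : inner ℝ e (logChart x₀ e l L k x) = Real.log (inner ℝ e y / l) / k := by
    rw [logChart, ← hy, inner_add_right, inner_smul_right, inner_smul_right, inner_sub_right,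
      inner_smul_right, real_inner_self_eq_norm_sq, he]
    ring
  rw [expChart, h1, mul_div_cancel₀ _ hk.ne', Real.exp_log (div_pos hx hl),
    mul_div_cancel₀ _ hl.ne', logChart, ← hy, smul_add, smul_inv_smul₀ hL.ne', smul_smul, sub_smul,
    ← sub_sub_cancel x₀ x, ← hy]
  abel

theorem range_expChart (he : ‖e‖ = 1) (hl : 0 < l) (hL : 0 < L) (hk : 0 < k) :
    expChart x₀ e l L k '' univ = {x | 0 < inner ℝ e (x₀ - x)} := by
  ext x
  constructor
  · rintro ⟨z, -, rfl⟩
    rw [mem_ofPred_eq, inner_sub_expChart he]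
    positivity
  · exact fun hx => ⟨_, mem_univ _, expChart_logChart he hl hL hk hx⟩

/-- The derivative of `expChart`. -/
noncomputable def expChartDeriv (e : EuclideanSpace ℝ (Fin N)) (l L k : ℝ)
    (z : EuclideanSpace ℝ (Fin N)) : EuclideanSpace ℝ (Fin N) →L[ℝ] EuclideanSpace ℝ (Fin N) :=
  -(L • ContinuousLinearMap.id ℝ _ +
    ((l * (Real.exp (k * inner ℝ e z) * k) - L) • innerSL ℝ e).smulRight e)

theorem hasFDerivAt_expChart (z : EuclideanSpace ℝ (Fin N)) :
    HasFDerivAt (expChart x₀ e l L k) (expChartDeriv e l L k z) z := by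
  have h1 : HasFDerivAt (fun z => inner ℝ e z) (innerSL ℝ e) z := (innerSL ℝ e).hasFDerivAt
  have h2 := ((((h1.const_mul k).exp.const_mul l).sub (h1.const_mul L)).smul_const e)
  refine ((((hasFDerivAt_id z).const_smul L).add h2).const_sub x₀).congr_fderiv ?_
  rw [expChartDeriv]
  congr 2
  ext v : 1
  simp [smul_smul]
  ring_nf

/-- The derivative is `-L` times a transvection along `e`: every direction orthogonal to `e` is
scaled by `L`, and `e` by `k t`, where `t = l exp (k ⟪e, z⟫)`. -/
theorem abs_det_expChartDeriv (hN : 1 ≤ N) (he : ‖e‖ = 1) (hl : 0 < l) (hL : 0 < L) (hk : 0 < k)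
    (z : EuclideanSpace ℝ (Fin N)) :
    |(expChartDeriv e l L k z).det| = L ^ (N - 1) * k * (l * Real.exp (k * inner ℝ e z)) := by
  set a := l * (Real.exp (k * inner ℝ e z) * k) with ha
  have h1 : (expChartDeriv e l L k z : EuclideanSpace ℝ (Fin N) →ₗ[ℝ] EuclideanSpace ℝ (Fin N)) =
      (-L) • LinearMap.transvection (((a - L) / L) • innerₗ (EuclideanSpace ℝ (Fin N)) e) e := by
    ext v : 1
    simp only [expChartDeriv, ContinuousLinearMap.coe_coe, LinearMap.smul_apply,
      LinearMap.transvection.apply]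
    simp [smul_smul]
    have h2 : L * ((a - L) / L * inner ℝ e v) = (a - L) * inner ℝ e v := by field_simp
    rw [h2, ha, add_comm]
  rw [ContinuousLinearMap.det, h1, LinearMap.det_smul, LinearMap.transvection.det]
  simp only [LinearMap.smul_apply, innerₗ_apply_apply, real_inner_self_eq_norm_sq, he,
    finrank_euclideanSpace_fin, smul_eq_mul, one_pow, mul_one]
  have h2 : 1 + (a - L) / L = a / L := by field_simp; ring
  have ha0 : 0 < a := by positivity
  rw [h2, abs_mul, abs_pow, abs_neg, abs_of_pos hL, abs_of_pos (div_pos ha0 hL)]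
  obtain ⟨m, rfl⟩ : ∃ m, N = m + 1 := ⟨N - 1, by omega⟩
  rw [Nat.add_sub_cancel, pow_succ, ha]
  field_simp

/-- The Jacobian is proportional to `t = ⟪e, x₀ - x⟫`, so `dx / t` becomes a constant multiple of
`dz`. The constant later cancels between numerator and denominator. -/
theorem lintegral_logChart (hN : 1 ≤ N) (he : ‖e‖ = 1) (hl : 0 < l) (hL : 0 < L) (hk : 0 < k)
    (H : EuclideanSpace ℝ (Fin N) → ℝ) :
    ∫⁻ x in {x | 0 < inner ℝ e (x₀ - x)},
        ENNReal.ofReal ((inner ℝ e (x₀ - x))⁻¹ * H (logChart x₀ e l L k x)) =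
      ENNReal.ofReal (L ^ (N - 1) * k) * ∫⁻ z, ENNReal.ofReal (H z) := by
  rw [← range_expChart he hl hL hk, lintegral_image_eq_lintegral_abs_det_fderiv_mul volume
    MeasurableSet.univ (fun z _ => (hasFDerivAt_expChart z).hasFDerivWithinAt)
    (fun z _ z' _ h => by
      rw [← logChart_expChart (x₀ := x₀) he hl hL hk z, h, logChart_expChart he hl hL hk]),
    Measure.restrict_univ, ← lintegral_const_mul' _ _ ENNReal.ofReal_ne_top]
  refine lintegral_congr fun z => ?_
  rw [abs_det_expChartDeriv hN he hl hL hk, inner_sub_expChart he, logChart_expChart he hl hL hk,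
    ← ENNReal.ofReal_mul (by positivity), ← ENNReal.ofReal_mul (by positivity)]
  congr 1
  field_simp

/-- The derivative of `logChart`. -/
noncomputable def logChartDeriv (x₀ e : EuclideanSpace ℝ (Fin N)) (L k : ℝ)
    (x : EuclideanSpace ℝ (Fin N)) : EuclideanSpace ℝ (Fin N) →L[ℝ] EuclideanSpace ℝ (Fin N) :=
  -(L⁻¹ • (ContinuousLinearMap.id ℝ _ - (innerSL ℝ e).smulRight e) +
    ((k * inner ℝ e (x₀ - x))⁻¹ • innerSL ℝ e).smulRight e)

theorem hasFDerivAt_inner_sub (x : EuclideanSpace ℝ (Fin N)) :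
    HasFDerivAt (fun x => inner ℝ e (x₀ - x)) (-innerSL ℝ e) x := by
  have := (innerSL ℝ e).hasFDerivAt.comp x ((hasFDerivAt_id x).const_sub x₀)
  refine this.congr_fderiv ?_
  ext v : 1
  simp

theorem hasFDerivAt_logChart (hl : 0 < l) {x : EuclideanSpace ℝ (Fin N)}
    (hx : 0 < inner ℝ e (x₀ - x)) :
    HasFDerivAt (logChart x₀ e l L k) (logChartDeriv x₀ e L k x) x := by
  have h1 := hasFDerivAt_inner_sub (x₀ := x₀) (e := e) x
  have h2 : HasFDerivAt (fun x => Real.log (inner ℝ e (x₀ - x) / l)) _ x :=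
    HasFDerivAt.log (h1.mul_const l⁻¹) (div_pos hx hl).ne'
  have h3 : HasFDerivAt (fun x => x₀ - x) (-ContinuousLinearMap.id ℝ _) x :=
    (hasFDerivAt_id x).const_sub x₀
  have h4 : HasFDerivAt (logChart x₀ e l L k) _ x :=
    ((h3.sub (h1.smul_const e)).const_smul L⁻¹).add ((h2.mul_const k⁻¹).smul_const e)
  refine h4.congr_fderiv ?_
  ext v : 1
  simp only [logChartDeriv]
  have h5 : k⁻¹ * (l / inner ℝ e (x₀ - x) * (l⁻¹ * inner ℝ e v)) =
      (inner ℝ e (x₀ - x))⁻¹ * k⁻¹ * inner ℝ e v := by field_simp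
  simp
  rw [h5, smul_sub]
  abel

theorem contDiffAt_logChart (hl : 0 < l) {n : WithTop ℕ∞} {x : EuclideanSpace ℝ (Fin N)}
    (hx : 0 < inner ℝ e (x₀ - x)) : ContDiffAt ℝ n (logChart x₀ e l L k) x := by
  have h1 : ContDiffAt ℝ n (fun x => inner ℝ e (x₀ - x)) x :=
    contDiffAt_const.inner ℝ (contDiffAt_const.sub contDiffAt_id)
  have h2 : ContDiffAt ℝ n (fun x => Real.log (inner ℝ e (x₀ - x) / l) / k) x :=
    ((h1.div_const l).log (div_pos hx hl).ne').div_const k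
  exact (((contDiffAt_const.sub contDiffAt_id).sub
    (h1.smul (contDiffAt_const (c := e)))).const_smul L⁻¹).add (h2.smul (contDiffAt_const (c := e)))

/-- In the region `k t ≤ L` the tangential rate `1 / L` does not exceed the normal rate `1 / (k t)`.
The constant is `2` for a crude bound on the tangential part plus `1` for the normal part. -/
theorem norm_logChartDeriv_le (he : ‖e‖ = 1) (hL : 0 < L) (hk : 0 < k)
    {x : EuclideanSpace ℝ (Fin N)} (hx : 0 < inner ℝ e (x₀ - x))
    (hxL : k * inner ℝ e (x₀ - x) ≤ L) :
    ‖logChartDeriv x₀ e L k x‖ ≤ 3 * (k * inner ℝ e (x₀ - x))⁻¹ := by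
  refine ContinuousLinearMap.opNorm_le_bound _ (by positivity) fun v => ?_
  have h1 : |inner ℝ e v| ≤ ‖v‖ := by
    simpa [he] using abs_real_inner_le_norm e v
  set q := (k * inner ℝ e (x₀ - x))⁻¹ with hq
  have hq0 : 0 < q := by positivity
  have h2 : L⁻¹ ≤ q := inv_anti₀ (by positivity) hxL
  have h3 : logChartDeriv x₀ e L k x v =
      -(L⁻¹ • (v - inner ℝ e v • e) + (q * inner ℝ e v) • e) := by
    simp [logChartDeriv, hq]
  rw [h3, norm_neg]
  calc ‖L⁻¹ • (v - inner ℝ e v • e) + (q * inner ℝ e v) • e‖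
      ≤ ‖L⁻¹ • (v - inner ℝ e v • e)‖ + ‖(q * inner ℝ e v) • e‖ := norm_add_le _ _
    _ = L⁻¹ * ‖v - inner ℝ e v • e‖ + q * |inner ℝ e v| := by
      rw [norm_smul, norm_smul, he, Real.norm_eq_abs, Real.norm_eq_abs, abs_mul,
        abs_of_pos hq0, abs_of_pos (inv_pos.2 hL), mul_one]
    _ ≤ q * (‖v‖ + ‖v‖) + q * ‖v‖ := by
      gcongr
      refine (norm_sub_le _ _).trans ?_
      rw [norm_smul, he, mul_one, Real.norm_eq_abs]
      gcongr
    _ = 3 * q * ‖v‖ := by ring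

end Chart

/-! ### Fitting the coordinates into the tangent ball -/

/-- A ball inside `ball 0 R` touching the sphere at `x₀` has its centre on the ray through `x₀`. -/
theorem sub_eq_smul_of_ball_subset_ball {R r : ℝ} {x₀ c : EuclideanSpace ℝ (Fin N)} (hR : 0 < R)
    (hr : 0 < r) (hx₀ : ‖x₀‖ = R) (hxc : ‖x₀ - c‖ = r) (hsub : ball c r ⊆ ball 0 R) :
    x₀ - c = r • (R⁻¹ • x₀) := by
  set e := R⁻¹ • x₀ with he
  have he1 : ‖e‖ = 1 := by
    rw [he, norm_smul, hx₀, norm_inv, Real.norm_eq_abs, abs_of_pos hR, inv_mul_cancel₀ hR.ne']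
  -- The point of the small closed ball farthest in direction `e` stays in the large one, which
  -- gives `⟪e, x₀ - c⟫ ≥ r = ‖x₀ - c‖`: the equality case of Cauchy–Schwarz.
  have hmem : c + r • e ∈ closedBall (0 : EuclideanSpace ℝ (Fin N)) R := by
    have h1 : closedBall c r ⊆ closedBall 0 R := by
      rw [← closure_ball c hr.ne', ← closure_ball 0 hR.ne']
      exact closure_mono hsub
    refine h1 ?_
    rw [mem_closedBall, dist_eq_norm, add_sub_cancel_left, norm_smul, he1, mul_one,
      Real.norm_eq_abs, abs_of_pos hr]
  rw [mem_closedBall_zero_iff] at hmem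
  have hee : inner ℝ e e = 1 := by rw [real_inner_self_eq_norm_sq, he1]; norm_num
  have h2 : inner ℝ e c + r ≤ R := by
    have := (real_inner_le_norm e (c + r • e)).trans
      (mul_le_mul_of_nonneg_left hmem (norm_nonneg e))
    rw [inner_add_right, inner_smul_right, hee, he1] at this
    linarith
  have hex : inner ℝ e x₀ = R := by
    rw [he, real_inner_smul_left, real_inner_self_eq_norm_sq, hx₀]; field_simp
  have h3 : r ≤ inner ℝ e (x₀ - c) := by
    rw [inner_sub_right, hex]; linarith
  have h4 : ‖(x₀ - c) - r • e‖ ^ 2 ≤ 0 := by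
    rw [norm_sub_sq_real, hxc, inner_smul_right, real_inner_comm, norm_smul, he1,
      Real.norm_eq_abs, abs_of_pos hr]
    nlinarith
  rw [← sub_eq_zero, ← norm_eq_zero]
  exact pow_eq_zero_iff two_ne_zero |>.1 (le_antisymm h4 (sq_nonneg _))

/-- The points close to `x₀` in exponential coordinates lie in the tangent ball. -/
theorem expChart_mem_ball {x₀ e c : EuclideanSpace ℝ (Fin N)} {r k : ℝ} (he : ‖e‖ = 1)
    (hr : 0 < r) (hk : 0 < k) (hxc : x₀ - c = r • e) {l : ℝ}
    (hl : l = r * Real.exp (-(3 * k)) / (1 + 2 * k) ^ 2) {z : EuclideanSpace ℝ (Fin N)}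
    (hz : ‖z‖ ≤ 1) : expChart x₀ e l (k * (l * Real.exp k)) k z ∈ ball c r := by
  have hl0 : 0 < l := by rw [hl]; positivity
  set L := k * (l * Real.exp k) with hL
  have hL0 : 0 < L := by positivity
  set t := l * Real.exp (k * inner ℝ e z) with ht
  have hez : |inner ℝ e z| ≤ 1 := by
    have := abs_real_inner_le_norm e z
    rw [he, one_mul] at this
    exact this.trans hz
  obtain ⟨hez1, hez2⟩ := abs_le.1 hez
  have ht1 : t ≤ l * Real.exp k := by
    rw [ht]; gcongr; nlinarith
  have ht2 : l * Real.exp (-k) ≤ t := by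
    rw [ht]; gcongr; nlinarith
  have ht0 : 0 < t := by positivity
  set y := x₀ - expChart x₀ e l L k z with hy
  have hyt : inner ℝ e y = t := inner_sub_expChart he z
  have hyn : ‖y‖ ≤ l * Real.exp k * (1 + 2 * k) := by
    have e1 : y = t • e + L • (z - inner ℝ e z • e) := by
      rw [hy, expChart, sub_sub_cancel]; module
    have e2 : ‖z - inner ℝ e z • e‖ ≤ 2 := by
      refine (norm_sub_le _ _).trans ?_
      rw [norm_smul, he, Real.norm_eq_abs]; linarith
    rw [e1]
    refine (norm_add_le _ _).trans ?_
    rw [norm_smul, norm_smul, he, Real.norm_eq_abs, Real.norm_eq_abs, abs_of_pos ht0,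
      abs_of_pos hL0]
    have := mul_le_mul_of_nonneg_left e2 hL0.le
    rw [hL] at *
    linarith
  -- Since `‖r • e - y‖² = r² - 2 r t + ‖y‖²`, this is membership in the ball. The choice of `l`
  -- makes the square of the bound on `‖y‖` equal to `r l exp (-k)`, hence at most `r t`.
  have key : ‖y‖ ^ 2 < 2 * r * t := by
    have e1 : ‖y‖ ^ 2 ≤ (l * Real.exp k * (1 + 2 * k)) ^ 2 := by gcongr
    have e2 : (l * Real.exp k * (1 + 2 * k)) ^ 2 = r * (l * Real.exp (-k)) := by
      have e3 : Real.exp (-(3 * k)) * Real.exp k ^ 2 = Real.exp (-k) := by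
        rw [← Real.exp_nat_mul, ← Real.exp_add]; congr 1; push_cast; ring
      have e4 : l * (1 + 2 * k) ^ 2 = r * Real.exp (-(3 * k)) := by
        rw [hl]; field_simp
      calc _ = l * (l * (1 + 2 * k) ^ 2) * Real.exp k ^ 2 := by ring
        _ = l * r * (Real.exp (-(3 * k)) * Real.exp k ^ 2) := by rw [e4]; ring
        _ = _ := by rw [e3]; ring
    have e5 : r * (l * Real.exp (-k)) ≤ r * t := by gcongr
    have : 0 < r * t := by positivity
    linarith
  rw [mem_ball, dist_eq_norm]
  have e1 : expChart x₀ e l L k z - c = r • e - y := by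
    rw [← hxc, hy]; abel
  rw [e1]
  refine lt_of_pow_lt_pow_left₀ 2 hr.le ?_
  rw [norm_sub_sq_real, real_inner_smul_left, hyt, norm_smul, he, Real.norm_eq_abs, abs_of_pos hr]
  linarith

/-! ### The minimizing sequence -/

/-- The bump function used as profile of the minimizing sequence. -/
noncomputable def profileBump (N : ℕ) : ContDiffBump (0 : EuclideanSpace ℝ (Fin N)) :=
  ⟨1 / 2, 1, by norm_num, by norm_num⟩

/-- The elements `t^α Φ` of the minimizing sequence, in exponential coordinates. -/
noncomputable def nearMinimizer (x₀ e : EuclideanSpace ℝ (Fin N)) (α l L k : ℝ)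
    (x : EuclideanSpace ℝ (Fin N)) : ℝ :=
  open Classical in if 0 < inner ℝ e (x₀ - x) then
    (inner ℝ e (x₀ - x)) ^ α * profileBump N (logChart x₀ e l L k x) else 0

section NearMinimizer

variable {x₀ e : EuclideanSpace ℝ (Fin N)} {α l L k : ℝ}

theorem isOpen_halfSpace : IsOpen {x : EuclideanSpace ℝ (Fin N) | 0 < inner ℝ e (x₀ - x)} :=
  isOpen_lt continuous_const (by fun_prop)

theorem nearMinimizer_eventuallyEq {x : EuclideanSpace ℝ (Fin N)} (hx : 0 < inner ℝ e (x₀ - x)) :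
    nearMinimizer x₀ e α l L k =ᶠ[𝓝 x] fun x =>
      (inner ℝ e (x₀ - x)) ^ α * profileBump N (logChart x₀ e l L k x) := by
  filter_upwards [isOpen_halfSpace.mem_nhds hx] with y hy
  exact if_pos hy

theorem support_nearMinimizer_subset (he : ‖e‖ = 1) (hl : 0 < l) (hL : 0 < L) (hk : 0 < k) :
    Function.support (nearMinimizer x₀ e α l L k) ⊆ expChart x₀ e l L k '' closedBall 0 1 := by
  intro x hx
  rw [Function.mem_support, nearMinimizer] at hx
  split_ifs at hx with h
  · have h2 : logChart x₀ e l L k x ∈ Function.support (profileBump N) := by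
      rw [Function.mem_support]; exact right_ne_zero_of_mul hx
    rw [(profileBump N).support_eq] at h2
    exact ⟨_, ball_subset_closedBall h2, expChart_logChart he hl hL hk h⟩
  · exact absurd rfl hx

/-- The support lies in the chart image of a closed ball, a compact subset of the open half-space,
where `t ^ α` and the chart are smooth. -/
theorem isTestFunction_nearMinimizer (he : ‖e‖ = 1) (hl : 0 < l) (hL : 0 < L) (hk : 0 < k)
    {Ω : Set (EuclideanSpace ℝ (Fin N))} (hΩ : expChart x₀ e l L k '' closedBall 0 1 ⊆ Ω) :
    IsTestFunction Ω (nearMinimizer x₀ e α l L k) := by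
  have hcont : Continuous (expChart x₀ e l L k) :=
    continuous_iff_continuousAt.2 fun z => (hasFDerivAt_expChart z).continuousAt
  have hK : IsCompact (expChart x₀ e l L k '' closedBall 0 1) :=
    (isCompact_closedBall _ _).image hcont
  have hts : tsupport (nearMinimizer x₀ e α l L k) ⊆ expChart x₀ e l L k '' closedBall 0 1 :=
    closure_minimal (support_nearMinimizer_subset he hl hL hk) hK.isClosed
  refine ⟨contDiff_iff_contDiffAt.2 fun x => ?_, HasCompactSupport.of_support_subset_isCompact hK
    (support_nearMinimizer_subset he hl hL hk), hts.trans hΩ⟩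
  by_cases hx : x ∈ tsupport (nearMinimizer x₀ e α l L k)
  · have hpos : 0 < inner ℝ e (x₀ - x) := by
      obtain ⟨z, -, rfl⟩ := hts hx
      rw [inner_sub_expChart he]; positivity
    refine ContDiffAt.congr_of_eventuallyEq ?_ (nearMinimizer_eventuallyEq hpos)
    have h1 : ContDiffAt ℝ ∞ (fun x => inner ℝ e (x₀ - x)) x :=
      contDiffAt_const.inner ℝ (contDiffAt_const.sub contDiffAt_id)
    exact (h1.rpow_const_of_ne hpos.ne').mul
      ((profileBump N).contDiff.contDiffAt.comp x (contDiffAt_logChart hl hpos))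
  · exact (contDiffAt_const (c := (0 : ℝ))).congr_of_eventuallyEq
      (notMem_tsupport_iff_eventuallyEq.1 hx)

/-- Product rule, with `‖logChartDeriv‖ ≤ 3 / (k t)` on the term containing the derivative of the
bump. The value `L = k l exp k` bounds `k t` on `‖z‖ ≤ 1`, as that estimate requires. -/
theorem norm_fderiv_nearMinimizer_le (he : ‖e‖ = 1) (hα : 0 ≤ α) (hl : 0 < l) (hk : 0 < k)
    {x : EuclideanSpace ℝ (Fin N)} (hx : 0 < inner ℝ e (x₀ - x)) :
    ‖fderiv ℝ (nearMinimizer x₀ e α l (k * (l * Real.exp k)) k) x‖ ≤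
      (inner ℝ e (x₀ - x)) ^ (α - 1) *
        (α * profileBump N (logChart x₀ e l (k * (l * Real.exp k)) k x) +
          3 / k * ‖fderiv ℝ (profileBump N) (logChart x₀ e l (k * (l * Real.exp k)) k x)‖) := by
  set L := k * (l * Real.exp k) with hL
  have hL0 : 0 < L := by positivity
  set t := inner ℝ e (x₀ - x) with ht
  set z := logChart x₀ e l L k x with hz
  have hΦ : ContDiff ℝ 1 (profileBump N) := (profileBump N).contDiff
  have h1 : HasFDerivAt (fun x => (inner ℝ e (x₀ - x)) ^ α) ((α * t ^ (α - 1)) • (-innerSL ℝ e)) x :=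
    (hasFDerivAt_inner_sub x).rpow_const (.inl hx.ne')
  have h2 : HasFDerivAt (fun x => profileBump N (logChart x₀ e l L k x))
      ((fderiv ℝ (profileBump N) z).comp (logChartDeriv x₀ e L k x)) x :=
    HasFDerivAt.comp (g := profileBump N) x (hΦ.differentiable one_ne_zero z).hasFDerivAt
      (hasFDerivAt_logChart hl hx)
  have h3 : HasFDerivAt (fun x => (inner ℝ e (x₀ - x)) ^ α *
      profileBump N (logChart x₀ e l L k x)) _ x := h1.mul h2
  rw [(nearMinimizer_eventuallyEq hx).fderiv_eq, h3.fderiv]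
  have htα : 0 < t ^ α := Real.rpow_pos_of_pos hx _
  have hsplit : t ^ α = t ^ (α - 1) * t := by
    rw [← Real.rpow_add_one hx.ne', sub_add_cancel]
  have htα' : 0 < t ^ (α - 1) := Real.rpow_pos_of_pos hx _
  have hΦ0 : 0 ≤ profileBump N z := (profileBump N).nonneg
  have hA : ‖t ^ α • (fderiv ℝ (profileBump N) z).comp (logChartDeriv x₀ e L k x)‖ ≤
      t ^ (α - 1) * (3 / k * ‖fderiv ℝ (profileBump N) z‖) := by
    by_cases hz1 : z ∈ tsupport (profileBump N)
    · rw [(profileBump N).tsupport_eq, mem_closedBall_zero_iff] at hz1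
      have hz1 : ‖z‖ ≤ 1 := hz1
      have hez : inner ℝ e z ≤ 1 := by
        have := real_inner_le_norm e z
        rw [he, one_mul] at this
        exact this.trans hz1
      have htz : t = l * Real.exp (k * inner ℝ e z) := by
        rw [← inner_sub_expChart (x₀ := x₀) (L := L) he z, hz, expChart_logChart he hl hL0 hk hx]
      have htL : k * t ≤ L := by
        rw [htz, hL]; gcongr; nlinarith
      have h3 := norm_logChartDeriv_le he hL0 hk hx htL
      rw [norm_smul, Real.norm_eq_abs, abs_of_pos htα]
      calc t ^ α * ‖(fderiv ℝ (profileBump N) z).comp (logChartDeriv x₀ e L k x)‖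
          ≤ t ^ α * (‖fderiv ℝ (profileBump N) z‖ * (3 * (k * t)⁻¹)) := by
            gcongr
            exact (ContinuousLinearMap.opNorm_comp_le _ _).trans (by gcongr)
        _ = _ := by rw [hsplit]; field_simp
    · rw [fderiv_of_notMem_tsupport ℝ hz1]
      simp
  have hB : ‖(profileBump N z) • ((α * t ^ (α - 1)) • (-innerSL ℝ e))‖ ≤
      t ^ (α - 1) * (α * profileBump N z) := by
    rw [norm_smul, norm_smul, norm_neg, innerSL_apply_norm, he, Real.norm_eq_abs, Real.norm_eq_abs,
      abs_of_nonneg hΦ0, abs_of_nonneg (by positivity)]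
    exact le_of_eq (by ring)
  refine (norm_add_le _ _).trans ?_
  rw [mul_add]
  linarith

end NearMinimizer

/-- For large `k` the perturbed profile has almost the same integral as `α Φ`. -/
theorem exists_profile_integral_le (hN : N ≠ 0) {α q : ℝ} (hα : 0 ≤ α) (hq : α ^ N < q) :
    ∃ k : ℝ, 0 < k ∧ 0 < ∫⁻ z, ENNReal.ofReal (profileBump N z ^ N) ∧
      ∫⁻ z, ENNReal.ofReal ((α * profileBump N z + 3 / k * ‖fderiv ℝ (profileBump N) z‖) ^ N) ≤
        ENNReal.ofReal q * ∫⁻ z, ENNReal.ofReal (profileBump N z ^ N) := by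
  have hΦ : ContDiff ℝ 1 (profileBump N) := (profileBump N).contDiff
  have hΦc := hΦ.continuous
  have hΦd := (hΦ.continuous_fderiv one_ne_zero).norm
  have hsupp : HasCompactSupport (profileBump N) := (profileBump N).hasCompactSupport
  have hΦ0 : ∀ z, 0 ≤ profileBump N z := fun z => (profileBump N).nonneg
  have hint : ∀ s : ℝ, Integrable fun z =>
      (α * profileBump N z + s * ‖fderiv ℝ (profileBump N) z‖) ^ N := fun s => by
    refine Continuous.integrable_of_hasCompactSupport (by fun_prop) ?_
    have h1 : HasCompactSupport fun z =>
        (α * profileBump N z + s * ‖fderiv ℝ (profileBump N) z‖) :=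
      hsupp.mul_left.add ((hsupp.fderiv ℝ).norm.mul_left)
    exact h1.comp_left (g := fun t : ℝ => t ^ N) (by simp [hN])
  have hintΦ : Integrable fun z => profileBump N z ^ N :=
    Continuous.integrable_of_hasCompactSupport (by fun_prop)
      (hsupp.comp_left (g := fun t : ℝ => t ^ N) (by simp [hN]))
  set J := ∫ z, profileBump N z ^ N with hJ
  have hJpos : 0 < J := by
    refine integral_pos_of_integrable_nonneg_nonzero (x := 0) (by fun_prop) hintΦ
      (fun z => pow_nonneg (hΦ0 z) N) ?_
    rw [(profileBump N).one_of_mem_closedBall (by simp [(profileBump N).rIn_pos.le])]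
    simp
  have hlim : Tendsto (fun n : ℕ => ∫ z, (α * profileBump N z +
      3 / ((n : ℝ) + 1) * ‖fderiv ℝ (profileBump N) z‖) ^ N) atTop (𝓝 (α ^ N * J)) := by
    rw [hJ, ← integral_const_mul]
    refine tendsto_integral_of_dominated_convergence
      (fun z => (α * profileBump N z + 3 * ‖fderiv ℝ (profileBump N) z‖) ^ N)
      (fun n => (hint _).1) (hint 3) (fun n => Eventually.of_forall fun z => ?_)
      (Eventually.of_forall fun z => ?_)
    · have h1 : 3 / ((n : ℝ) + 1) ≤ 3 := div_le_self (by norm_num) (by simp)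
      have := hΦ0 z
      rw [Real.norm_eq_abs, abs_of_nonneg (by positivity)]
      gcongr
    · have h1 : Tendsto (fun n : ℕ => 3 / ((n : ℝ) + 1)) atTop (𝓝 0) := by
        have := (tendsto_one_div_add_atTop_nhds_zero_nat (𝕜 := ℝ)).const_mul 3
        simpa [div_eq_mul_inv] using this
      have h2 := (((h1.mul_const ‖fderiv ℝ (profileBump N) z‖).const_add
        (α * profileBump N z)).pow N)
      rwa [zero_mul, add_zero, mul_pow] at h2
  have hlt : α ^ N * J < q * J := by gcongr
  obtain ⟨n, hn⟩ := (hlim.eventually_lt_const hlt).exists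
  have hJe : ∫⁻ z, ENNReal.ofReal (profileBump N z ^ N) = ENNReal.ofReal J :=
    (ofReal_integral_eq_lintegral_ofReal hintΦ
      (Eventually.of_forall fun z => pow_nonneg (hΦ0 z) N)).symm
  refine ⟨n + 1, by positivity, ?_, ?_⟩
  · rw [hJe]; exact ENNReal.ofReal_pos.2 hJpos
  · rw [hJe, ← ENNReal.ofReal_mul ((pow_nonneg hα N).trans hq.le),
      ← ofReal_integral_eq_lintegral_ofReal (hint _)
        (Eventually.of_forall fun z => by have := hΦ0 z; positivity)]
    exact ENNReal.ofReal_le_ofReal hn.le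

/-- From `log s ≤ s - 1` and Cauchy–Schwarz, `|x| log (R / |x|) ≤ R - |x| ≤ t`, where `t` is the
distance to the tangent hyperplane. -/
theorem inv_pow_le_weight {R : ℝ} {x₀ x : EuclideanSpace ℝ (Fin N)} (hR : 0 < R) (hx₀ : ‖x₀‖ = R)
    (hx0 : x ≠ 0) (hx : ‖x‖ < R) :
    ((inner ℝ (R⁻¹ • x₀) (x₀ - x)) ^ N)⁻¹ ≤ weight R x ∧ 0 < inner ℝ (R⁻¹ • x₀) (x₀ - x) := by
  have hn := norm_pos_iff.2 hx0
  have hτ := log_div_norm_pos hx0 hx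
  have h1 : ‖x‖ * Real.log (R / ‖x‖) ≤ R - ‖x‖ := by
    have := mul_le_mul_of_nonneg_left (Real.log_le_sub_one_of_pos (div_pos hR hn)) hn.le
    calc _ ≤ ‖x‖ * (R / ‖x‖ - 1) := this
      _ = R - ‖x‖ := by field_simp
  have h2 : R - ‖x‖ ≤ inner ℝ (R⁻¹ • x₀) (x₀ - x) := by
    have h3 : inner ℝ (R⁻¹ • x₀) x₀ = R := by
      rw [real_inner_smul_left, real_inner_self_eq_norm_sq, hx₀]; field_simp
    have h4 := real_inner_le_norm (R⁻¹ • x₀) x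
    rw [norm_smul, hx₀, norm_inv, Real.norm_eq_abs, abs_of_pos hR, inv_mul_cancel₀ hR.ne',
      one_mul] at h4
    rw [inner_sub_right, h3]
    linarith
  refine ⟨?_, by linarith⟩
  rw [weight, ← mul_pow, one_div]
  exact inv_anti₀ (by positivity) (pow_le_pow_left₀ (by positivity) (h1.trans h2) N)

theorem exists_test_hardy_le (hN : 2 ≤ N) {R : ℝ} (hR : 0 < R)
    {Ω : Set (EuclideanSpace ℝ (Fin N))} (hΩ : IsOpen Ω) (hsub : Ω ⊆ ball 0 R)
    {x₀ c : EuclideanSpace ℝ (Fin N)} {r : ℝ} (hr : 0 < r) (hball : ball c r ⊆ Ω)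
    (hx₀ : ‖x₀‖ = R) (hxc : ‖x₀ - c‖ = r) {q : ℝ} (hq : (((N : ℝ) - 1) / N) ^ N < q) :
    ∃ φ, IsTestFunction Ω φ ∧ 0 < ∫⁻ x in Ω, ENNReal.ofReal (weight R x * |φ x| ^ N) ∧
      ∫⁻ x in Ω, ENNReal.ofReal (‖gradient φ x‖ ^ N) ≤
        ENNReal.ofReal q * ∫⁻ x in Ω, ENNReal.ofReal (weight R x * |φ x| ^ N) := by
  have hN0 : N ≠ 0 := by omega
  have hNpos : (0 : ℝ) < N := by positivity
  have hN1 : (0 : ℝ) < N - 1 := by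
    have : (2 : ℝ) ≤ N := by exact_mod_cast hN
    linarith
  set α : ℝ := ((N : ℝ) - 1) / N with hα
  have hα0 : 0 < α := by positivity
  have hNα : α * N = N - 1 := by rw [hα]; field_simp
  obtain ⟨k, hk, hJ, hIJ⟩ := exists_profile_integral_le hN0 hα0.le hq
  set e := R⁻¹ • x₀ with he
  have he1 : ‖e‖ = 1 := by
    rw [he, norm_smul, hx₀, norm_inv, Real.norm_eq_abs, abs_of_pos hR, inv_mul_cancel₀ hR.ne']
  set l := r * Real.exp (-(3 * k)) / (1 + 2 * k) ^ 2 with hl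
  have hl0 : 0 < l := by positivity
  set L := k * (l * Real.exp k) with hL
  have hL0 : 0 < L := by positivity
  have htan := sub_eq_smul_of_ball_subset_ball hR hr hx₀ hxc (hball.trans hsub)
  have himage : expChart x₀ e l L k '' closedBall 0 1 ⊆ Ω := by
    rintro - ⟨z, hz, rfl⟩
    exact hball (expChart_mem_ball he1 hr hk htan hl (mem_closedBall_zero_iff.1 hz))
  set φ := nearMinimizer x₀ e α l L k with hφ
  set P : Set (EuclideanSpace ℝ (Fin N)) := {x | 0 < inner ℝ e (x₀ - x)} with hP
  have hPm : MeasurableSet P := isOpen_halfSpace.measurableSet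
  have hφP : ∀ x, 0 < inner ℝ e (x₀ - x) →
      φ x = (inner ℝ e (x₀ - x)) ^ α * profileBump N (logChart x₀ e l L k x) := fun x hx =>
    if_pos hx
  -- Because `α N = N - 1`, both `t^{-N} (t^α)^N` and `(t^{α-1})^N` equal `t⁻¹`, the density that
  -- the chart flattens.
  have hpow : ∀ {t : ℝ}, 0 < t → (t ^ α) ^ N = t ^ N * t⁻¹ := fun {t} ht => by
    rw [← Real.rpow_natCast, ← Real.rpow_mul ht.le, hNα, Real.rpow_sub_one ht.ne',
      Real.rpow_natCast, div_eq_mul_inv]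
  have hpow' : ∀ {t : ℝ}, 0 < t → (t ^ (α - 1)) ^ N = t⁻¹ := fun {t} ht => by
    rw [Real.rpow_sub_one ht.ne', div_pow, hpow ht]
    field_simp
  set m := ENNReal.ofReal (L ^ (N - 1) * k) with hm
  have hm0 : 0 < m := ENNReal.ofReal_pos.2 (by positivity)
  have hmem := ae_restrict_mem (μ := volume) hΩ.measurableSet
  have hne := ae_ne_zero_of_two_le hN Ω
  have hden : m * ∫⁻ z, ENNReal.ofReal (profileBump N z ^ N) ≤
      ∫⁻ x in Ω, ENNReal.ofReal (weight R x * |φ x| ^ N) := by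
    rw [hm, ← lintegral_logChart (x₀ := x₀) (by omega : 1 ≤ N) he1 hl0 hL0 hk]
    calc ∫⁻ x in P, ENNReal.ofReal ((inner ℝ e (x₀ - x))⁻¹ *
          profileBump N (logChart x₀ e l L k x) ^ N)
        = ∫⁻ x in P, ENNReal.ofReal (((inner ℝ e (x₀ - x)) ^ N)⁻¹ * |φ x| ^ N) := by
          refine setLIntegral_congr_fun hPm fun x hx => ?_
          have hx : 0 < inner ℝ e (x₀ - x) := hx
          rw [hφP x hx, abs_mul, abs_of_pos (Real.rpow_pos_of_pos hx _),
            abs_of_nonneg (profileBump N).nonneg, mul_pow, hpow hx]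
          congr 1
          field_simp
      _ ≤ ∫⁻ x, ENNReal.ofReal (((inner ℝ e (x₀ - x)) ^ N)⁻¹ * |φ x| ^ N) :=
          setLIntegral_le_lintegral _ _
      _ = ∫⁻ x in Ω, ENNReal.ofReal (((inner ℝ e (x₀ - x)) ^ N)⁻¹ * |φ x| ^ N) := by
          rw [← lintegral_indicator hΩ.measurableSet]
          refine lintegral_congr fun x => ?_
          by_cases hx : x ∈ Ω
          · simp [hx]
          · have h0 : φ x = 0 := by
              by_contra h
              exact hx (himage (support_nearMinimizer_subset he1 hl0 hL0 hk h))
            simp [hx, h0, hN0]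
      _ ≤ _ := by
          refine lintegral_mono_ae ?_
          filter_upwards [hmem, hne] with x hx hx0
          refine ENNReal.ofReal_le_ofReal (mul_le_mul_of_nonneg_right ?_ (by positivity))
          exact (inv_pow_le_weight hR hx₀ hx0 (mem_ball_zero_iff.1 (hsub hx))).1
  have hnum : ∫⁻ x in Ω, ENNReal.ofReal (‖gradient φ x‖ ^ N) ≤
      m * ∫⁻ z, ENNReal.ofReal ((α * profileBump N z +
        3 / k * ‖fderiv ℝ (profileBump N) z‖) ^ N) := by
    rw [hm, ← lintegral_logChart (x₀ := x₀) (by omega : 1 ≤ N) he1 hl0 hL0 hk]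
    have hΩP : Ω ≤ᵐ[volume] P := by
      have := (ae_restrict_iff' hΩ.measurableSet).1 hne
      filter_upwards [this] with x hx hxΩ
      exact (inv_pow_le_weight hR hx₀ (hx hxΩ) (mem_ball_zero_iff.1 (hsub hxΩ))).2
    refine (lintegral_mono' (Measure.restrict_mono' hΩP le_rfl) le_rfl).trans ?_
    refine setLIntegral_mono' hPm fun x hx => ENNReal.ofReal_le_ofReal ?_
    have hx : 0 < inner ℝ e (x₀ - x) := hx
    rw [norm_gradient_eq, ← hpow' hx, ← mul_pow]
    exact pow_le_pow_left₀ (norm_nonneg _) (norm_fderiv_nearMinimizer_le he1 hα0.le hl0 hk hx) N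
  refine ⟨φ, isTestFunction_nearMinimizer he1 hl0 hL0 hk himage, ?_, ?_⟩
  · exact lt_of_lt_of_le (ENNReal.mul_pos hm0.ne' hJ.ne') hden
  · calc _ ≤ _ := hnum
      _ ≤ m * (ENNReal.ofReal q * ∫⁻ z, ENNReal.ofReal (profileBump N z ^ N)) := by gcongr
      _ = ENNReal.ofReal q * (m * ∫⁻ z, ENNReal.ofReal (profileBump N z ^ N)) :=
        mul_left_comm _ _ _
      _ ≤ _ := by gcongr

/-! ### Admissibility, positivity and conclusion -/

theorem IsTestFunction.isSobolevZero {Ω : Set (EuclideanSpace ℝ (Fin N))} (p : ℝ≥0∞)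
    {φ : EuclideanSpace ℝ (Fin N) → ℝ} (hφ : IsTestFunction Ω φ) :
    IsSobolevZero p Ω φ (gradient φ) := by
  have hcg := hφ.continuous_gradient
  have hsg : HasCompactSupport (gradient φ) :=
    (hφ.2.1.fderiv ℝ).comp_left (g := (InnerProductSpace.toDual ℝ _).symm) (map_zero _)
  have hd : Differentiable ℝ φ := hφ.1.differentiable (by simp)
  refine ⟨⟨(hφ.1.continuous.memLp_of_hasCompactSupport hφ.2.1).restrict _,
    (hcg.memLp_of_hasCompactSupport hsg).restrict _,
    hφ.1.continuous.locallyIntegrable.locallyIntegrableOn _,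
    hcg.locallyIntegrable.locallyIntegrableOn _, fun ψ hψ => ?_⟩, fun ε hε => ⟨φ, hφ, ?_⟩⟩
  · have hdψ : Differentiable ℝ ψ := hψ.1.differentiable (by simp)
    have i1 : Integrable fun x => φ x • gradient ψ x :=
      (hφ.1.continuous.smul hψ.continuous_gradient).integrable_of_hasCompactSupport
        hφ.2.1.smul_right
    have i2 : Integrable fun x => ψ x • gradient φ x :=
      (hψ.1.continuous.smul hcg).integrable_of_hasCompactSupport hψ.2.1.smul_right
    have i3 : Integrable fun x => φ x * ψ x :=
      (hφ.1.continuous.mul hψ.1.continuous).integrable_of_hasCompactSupport hφ.2.1.mul_right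
    rw [setIntegral_eq_integral_of_forall_compl_eq_zero fun x hx => by
        simp [(gradient_eq_zero_of_notMem hφ hx).1],
      setIntegral_eq_integral_of_forall_compl_eq_zero fun x hx => by
        simp [(gradient_eq_zero_of_notMem hψ hx).1]]
    refine ext_inner_left ℝ fun v => ?_
    rw [inner_neg_right, ← integral_inner i1, ← integral_inner i2]
    have e1 : ∀ x, inner ℝ v (φ x • gradient ψ x) = φ x * fderiv ℝ ψ x v := fun x => by
      rw [inner_smul_right, real_inner_comm, inner_gradient_left]
    have e2 : ∀ x, inner ℝ v (ψ x • gradient φ x) = fderiv ℝ φ x v * ψ x := fun x => by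
      rw [inner_smul_right, real_inner_comm, inner_gradient_left, mul_comm]
    have i1' := i1.const_inner (𝕜 := ℝ) v
    have i2' := i2.const_inner (𝕜 := ℝ) v
    simp_rw [e1] at i1' ⊢
    simp_rw [e2] at i2' ⊢
    exact integral_mul_fderiv_eq_neg_fderiv_mul_of_integrable i2' i1' i3
      (fun x _ => hd x) (fun x _ => hdψ x)
  · simpa using hε

/-- The weight is positive almost everywhere on `Ω`, so the denominator of the quotient never
vanishes and division in `ℝ≥0∞` has its usual meaning. -/
theorem lintegral_weight_pos (hN : 2 ≤ N) {R : ℝ}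
    {Ω : Set (EuclideanSpace ℝ (Fin N))} (hΩ : IsOpen Ω) (hsub : Ω ⊆ ball 0 R)
    {u : EuclideanSpace ℝ (Fin N) → ℝ} (hum : AEStronglyMeasurable u (volume.restrict Ω))
    (hu : ¬ u =ᵐ[volume.restrict Ω] 0) :
    ∫⁻ x in Ω, ENNReal.ofReal (weight R x * |u x| ^ N) ≠ 0 := by
  have hwm : Measurable (weight R : EuclideanSpace ℝ (Fin N) → ℝ) := by
    unfold weight; fun_prop
  have hN0 : N ≠ 0 := by omega
  have hm : AEMeasurable (fun x => ENNReal.ofReal (weight R x * |u x| ^ N))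
      (volume.restrict Ω) :=
    (hwm.aemeasurable.mul (hum.norm.pow N).aemeasurable).ennreal_ofReal
  rw [ne_eq, lintegral_eq_zero_iff' hm]
  contrapose! hu
  filter_upwards [hu, ae_restrict_mem hΩ.measurableSet, ae_ne_zero_of_two_le hN Ω] with x h1 hx hx0
  have hτ := log_div_norm_pos hx0 (mem_ball_zero_iff.1 (hsub hx))
  have hn := norm_pos_iff.2 hx0
  have h2 := ENNReal.ofReal_eq_zero.1 h1
  have h3 := le_antisymm h2 (weight_mul_nonneg (hsub hx) _)
  rw [weight_mul_eq_pow, pow_eq_zero_iff hN0, div_eq_zero_iff] at h3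
  exact abs_eq_zero.1 (h3.resolve_right (mul_pos hn hτ).ne')

/-- An open subset of the closed ball lies in its interior; hence `log (R / |x|) > 0` at every
nonzero point of `Ω`. -/
theorem subset_ball_outerRadius (hN : 2 ≤ N) {Ω : Set (EuclideanSpace ℝ (Fin N))}
    (hΩ : IsOpen Ω) (hb : Bornology.IsBounded Ω) : Ω ⊆ ball 0 (outerRadius Ω) := by
  have : Nonempty (Fin N) := ⟨⟨0, by omega⟩⟩
  obtain ⟨C, hC⟩ := hb.exists_norm_le
  have hbdd : BddAbove ((fun x => ‖x‖) '' Ω) := ⟨C, by rintro - ⟨x, hx, rfl⟩; exact hC x hx⟩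
  rw [← interior_closedBall']
  refine interior_maximal (fun x hx => ?_) hΩ
  rw [mem_closedBall_zero_iff]
  exact le_csSup hbdd ⟨x, hx, rfl⟩

end CriticalHardy

open CriticalHardy in
theorem theorem3p1 (N : ℕ) (hN : 2 ≤ N) (Ω : Set (EuclideanSpace ℝ (Fin N)))
    (hΩ_open : IsOpen Ω) (hΩ_conn : IsConnected Ω) (hΩ_bdd : Bornology.IsBounded Ω)
    (x₀ : EuclideanSpace ℝ (Fin N))
    (hx₀ : x₀ ∈ frontier Ω ∩ frontier (Metric.ball 0 (CriticalHardy.outerRadius Ω)))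
    (hsphere : CriticalHardy.InteriorSphereCondition Ω x₀) :
    CriticalHardy.bestConstant Ω = ENNReal.ofReal ((((N : ℝ) - 1) / N) ^ N) ∧
      ¬ CriticalHardy.IsAttained Ω := by
  have hN1 : (0 : ℝ) < N - 1 := by
    have : (2 : ℝ) ≤ N := by exact_mod_cast hN
    linarith
  have hN0 : (0 : ℝ) < N := by linarith
  have hαN : 0 < (((N : ℝ) - 1) / N) ^ N := by positivity
  set R := outerRadius Ω with hRdef
  have hsub := subset_ball_outerRadius hN hΩ_open hΩ_bdd
  have hR : 0 < R := by
    obtain ⟨x, hx⟩ := hΩ_conn.nonempty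
    exact (norm_nonneg x).trans_lt (mem_ball_zero_iff.1 (hsub hx))
  have hpos : ∀ u g, Admissible Ω u g →
      ∫⁻ x in Ω, ENNReal.ofReal (weight R x * |u x| ^ N) ≠ 0 := fun u g h =>
    lintegral_weight_pos hN hΩ_open hsub h.1.1.1.1 h.2
  have hnum : ∀ u g, Admissible Ω u g → ∫⁻ x in Ω, ENNReal.ofReal (‖g x‖ ^ N) ≠ ⊤ :=
    fun u g h => by
    rw [← ofReal_integral_eq_lintegral_ofReal
      (h.1.1.2.1.integrable_norm_pow (p := N) (by omega))
      (Filter.Eventually.of_forall fun x => by positivity)]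
    exact ENNReal.ofReal_ne_top
  have hbest : bestConstant Ω = ENNReal.ofReal ((((N : ℝ) - 1) / N) ^ N) := by
    refine le_antisymm ?_ (le_sInf ?_)
    · obtain ⟨c, r, hr, hball, hxc⟩ := hsphere
      rw [frontier_ball _ hr.ne', mem_sphere, dist_eq_norm] at hxc
      have hxR := hx₀.2
      rw [frontier_ball _ hR.ne', mem_sphere_zero_iff_norm] at hxR
      have hq : ∀ q : ℝ, (((N : ℝ) - 1) / N) ^ N < q → bestConstant Ω ≤ ENNReal.ofReal q :=
        fun q hq => by
        obtain ⟨φ, hφ, hden, hle⟩ :=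
          exists_test_hardy_le hN hR hΩ_open hsub hr hball hxR hxc hq
        have hadm : Admissible Ω φ (gradient φ) := by
          refine ⟨hφ.isSobolevZero _, fun h0 => hden.ne' ?_⟩
          rw [lintegral_congr_ae (g := fun _ => 0), lintegral_zero]
          filter_upwards [h0] with x hx
          simp [hx, show N ≠ 0 by omega]
        have hinf : bestConstant Ω ≤ quotient Ω φ (gradient φ) := sInf_le ⟨φ, _, hadm, rfl⟩
        exact hinf.trans (ENNReal.div_le_of_le_mul hle)
      -- Test functions reach every `q` above the constant, so let `q` decrease to it.
      refine ge_of_tendsto (f := fun q : ℝ => ENNReal.ofReal q)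
        (x := nhdsWithin ((((N : ℝ) - 1) / N) ^ N) (Ioi ((((N : ℝ) - 1) / N) ^ N))) ?_ ?_
      · exact (ENNReal.continuous_ofReal.tendsto _).mono_left nhdsWithin_le_nhds
      · filter_upwards [self_mem_nhdsWithin] with q hq' using hq q hq'
    · rintro - ⟨u, g, h, rfl⟩
      rw [quotient, ENNReal.le_div_iff_mul_le (.inl (hpos u g h)) (.inr (hnum u g h))]
      exact h.1.hardy hN hR hΩ_open hsub
  refine ⟨hbest, ?_⟩
  rintro ⟨u, g, h, hq⟩
  rw [hbest, quotient] at hq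
  refine h.2 (h.1.eq_zero_of_hardy_eq hN hR hΩ_open hsub ?_)
  -- By the Hardy inequality an infinite denominator would make the gradient integral infinite. Its
  -- finiteness lets the quotient be multiplied out into equality in the Hardy inequality.
  have htop : ∫⁻ x in Ω, ENNReal.ofReal (weight R x * |u x| ^ N) ≠ ⊤ := fun htop => by
    have := h.1.hardy hN hR hΩ_open hsub
    rw [htop, ENNReal.mul_top (by simpa using hαN)] at this
    exact hnum u g h (top_le_iff.1 this)
  rw [← hq, ENNReal.div_mul_cancel (hpos u g h) htop]
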